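/- Let $\Phi$ be the standard normal law. For a sequence $\{G_n\}$ of probability laws on $\mathbb R$ and $\beta\in[0,1]$ put $\pi_n=n^{-\beta}$, $H_0^n=\Phi^{\otimes n}$ and $H_1^n=\big((1-\pi_n)\Phi+\pi_n\,(G_n*\Phi)\big)^{\otimes n}$; $H_1^n$ is the law of $X\in\mathbb R^n$ with independent $X_i\sim N(\mu_i,1)$, where $\mu_i\overset{iid}\sim(1-\pi_n)\delta_0+\pi_nG_n$. Let $d_{TV}(P,Q)=\sup_A|P(A)-Q(A)|$. The sequence $\{G_n\}$ has critical sparsity level $\beta^*$ if $$\sup\{\beta\in[0,1]:\ d_{TV}(H_0^n,H_1^n)\to1\}=\inf\{\beta\in[0,1]:\ d_{TV}(H_0^n,H_1^n)\to0\}=\beta^*,$$ where supremum and infimum are taken in $[0,1]$ (so $\sup\emptyset=0$ and $\inf\emptyset=1$). The level-$\alpha$ max test rejects when $\max_i|X_i|$ exceeds its $1-\alpha$ quantile under $H_0^n$. It attains the critical sparsity level $\beta^*$ if, for all $\beta\in[0,\beta^*)$ and all $\alpha\in(0,1)$, its rejection probability under $H_1^n$ tends to $1$. Let $G$ be a probability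 law on $\mathbb R$ with density $g$, and let $G_n(\mu)=G(\mu/\sigma_n)$, i.e. $G_n$ is the law of $\sigma_n\theta$ with $\theta\sim G$. All asymptotic relations for $g$ are as $\theta\to+\infty$. 1. If $g(\theta)=\Theta(\theta^{-\nu-1})$ and $g(-\theta)=O(\theta^{-\nu-1})$ for some $\nu>0$, and $\sigma_n\sim n^\rho$ (the ratio tends to $1$) with $\rho>-\frac1{2\nu}$, then $\{G_n\}$ has critical sparsity level $\beta^*=\min\{\nu\rho+1,\,1\}$ (so $\beta^*=\nu\rho+1$ for $\rho\le0$). 2. If $g(\theta)=\Theta(e^{-\theta})$ and $g(-\theta)=O(e^{-\theta})$, and $\sigma_n=r(2\log n)^{-1/2}$ with $r>\sqrt2/(\sqrt2-1)$, then $\{G_n\}$ has critical sparsity level $\beta^*=(1-1/r)^2$. 3. If $g(\theta)=\Theta(e^{-(\theta-\gamma)^2/2})$ and $g(-\theta)=O(e^{-(\theta-\gamma')^2/2})$ for some $\gamma,\gamma'\in\mathbb R$, and $\sigma_n=r$ with $r>1$, then $\{G_n\}$ has critical sparsity level $\beta^*=\dfrac{r^2}{r^2+1}$. In all three cases the max test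 attains the critical sparsity level $\beta^*$. -/

import Mathlib

open MeasureTheory ProbabilityTheory Filter Asymptotics
open scoped Topology

noncomputable section

namespace GlobalNull

/-- Total variation distance `sup_A |P(A) - Q(A)|`, over measurable sets `A`. -/
def tvDist {Ω : Type*} [MeasurableSpace Ω] (P Q : Measure Ω) : ℝ :=
  ⨆ A : {A : Set Ω // MeasurableSet A}, |P.real A - Q.real A|

/-- Law of `X` under the global null `H₀ⁿ`: `n` independent standard normal variables. -/
def nullLaw (n : ℕ) : Measure (Fin n → ℝ) :=
  Measure.pi fun _ => gaussianReal 0 1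

/-- Law of one coordinate under the alternative: `(1 - p) Φ + p (G * Φ)`, i.e. the law of `μ + Z`
with `μ ∼ (1 - p) δ₀ + p G` and an independent standard normal `Z`. -/
def mixtureLaw (p : ℝ) (G : Measure ℝ) : Measure ℝ :=
  ENNReal.ofReal (1 - p) • gaussianReal 0 1 +
    ENNReal.ofReal p • Measure.conv G (gaussianReal 0 1)

/-- Law of `X` under the alternative `H₁ⁿ` with proportion `π_n = n ^ (-β)` of nonzero means and
distribution `G n` of the nonzero means. -/
def altLaw (G : ℕ → Measure ℝ) (β : ℝ) (n : ℕ) : Measure (Fin n → ℝ) :=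
  Measure.pi fun _ => mixtureLaw ((n : ℝ) ^ (-β)) (G n)

/-- Supremum in `[0, 1]` of the sparsity levels at which null and alternative separate perfectly. -/
def lowerCriticalSparsity (G : ℕ → Measure ℝ) : unitInterval :=
  sSup {β : unitInterval |
    Tendsto (fun n : ℕ => tvDist (nullLaw n) (altLaw G (β : ℝ) n)) atTop (𝓝 1)}

/-- Infimum in `[0, 1]` of the sparsity levels at which null and alternative merge
(so it is `1` if there is none). -/
def upperCriticalSparsity (G : ℕ → Measure ℝ) : unitInterval :=
  sInf {β : unitInterval |
    Tendsto (fun n : ℕ => tvDist (nullLaw n) (altLaw G (β : ℝ) n)) atTop (𝓝 0)}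

/-- The sequence `G` has a critical sparsity level, and it is equal to `b`. -/
def IsCriticalSparsity (G : ℕ → Measure ℝ) (b : ℝ) : Prop :=
  (lowerCriticalSparsity G : ℝ) = b ∧ (upperCriticalSparsity G : ℝ) = b

/-- The `1 - α` quantile of `max_i |X_i|` under the global null. -/
def maxThreshold (n : ℕ) (α : ℝ) : ℝ :=
  sInf {t : ℝ | 1 - α ≤ (nullLaw n).real {x | ∀ i, |x i| ≤ t}}

/-- Rejection region of the level-`α` max test: `max_i |X_i|` exceeds its null quantile. -/
def maxTest (α : ℝ) (n : ℕ) : Set (Fin n → ℝ) :=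
  {x | ∃ i, maxThreshold n α < |x i|}

/-- A family of tests, given by the rejection region `R α n` at level `α` and sample size `n`, has
full asymptotic power against the alternatives with sparsity `β`: for each level, the probability
of rejection under `H₁ⁿ` tends to `1`. -/
def HasFullAsymptoticPower (R : (α : ℝ) → (n : ℕ) → Set (Fin n → ℝ)) (G : ℕ → Measure ℝ)
    (β : ℝ) : Prop :=
  ∀ α : ℝ, 0 < α → α < 1 → Tendsto (fun n : ℕ => (altLaw G β n).real (R α n)) atTop (𝓝 1)

/-- The sequence `G` has the critical sparsity level `b`, and the max test has full asymptotic
power at every sparsity level below `b`. -/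
def MaxTestAttainsCriticalSparsity (G : ℕ → Measure ℝ) (b : ℝ) : Prop :=
  IsCriticalSparsity G b ∧ ∀ β : ℝ, 0 ≤ β → β < b → HasFullAsymptoticPower maxTest G β

/-- The scale family `G_n(μ) = G(μ / σ_n)`: the law of `σ_n θ` with `θ ∼ G`. -/
def scaleFamily (G : Measure ℝ) (σ : ℕ → ℝ) (n : ℕ) : Measure ℝ :=
  G.map fun θ => σ n * θ

end GlobalNull

end

/-! Everything rests on the smoothed tail `J(y) = E exp (-(y - |μ|)₊² / 2)` of `μ ∼ G_n`: up to a
factor `2` it bounds the probability that `|μ + Z|` exceeds `y`, and `e^{y²/2} J(|y|)` bounds the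
likelihood ratio of `G_n * Φ` to `Φ` at `y`. If `J(y) ≤ n^{b - 1/2 + o(1)} e^{-y²/4}` for
`0 ≤ y ≤ t_n = √(2 log n)`, then for `β > b` no coordinate exceeds `t_n` in absolute value with
probability tending to `1`, and the second moment of the likelihood ratio truncated to that event
tends to `1`, so null and alternative merge. If instead the exceedance probability of `t_n` is at
least `n^{b - 1 - o(1)}`, then for `β < b` some coordinate exceeds `t_n` with probability tending
to `1` under the alternative but to `0` under the null, so they separate and the max test has full
power. For Gaussian and exponential tails `J` is bounded by a Chernoff bound in `|μ|`, for
polynomial tails by splitting at `|μ| = 1`. -/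

namespace GlobalNull

section TotalVariation

variable {Ω : Type*} [MeasurableSpace Ω] {P Q : Measure Ω}

theorem tvDist_le {c : ℝ} (h : ∀ A, MeasurableSet A → |P.real A - Q.real A| ≤ c) :
    tvDist P Q ≤ c :=
  haveI : Nonempty {A : Set Ω // MeasurableSet A} := ⟨⟨∅, MeasurableSet.empty⟩⟩
  ciSup_le fun A => h A.1 A.2

theorem tvDist_nonneg : 0 ≤ tvDist P Q :=
  Real.iSup_nonneg fun _ => abs_nonneg _

section ProbabilityMeasure

variable [IsProbabilityMeasure P] [IsProbabilityMeasure Q]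

theorem abs_real_sub_real_le_one (A : Set Ω) : |P.real A - Q.real A| ≤ 1 :=
  abs_sub_le_of_nonneg_of_le measureReal_nonneg measureReal_le_one measureReal_nonneg
    measureReal_le_one

theorem tvDist_le_one : tvDist P Q ≤ 1 :=
  tvDist_le fun A _ => abs_real_sub_real_le_one A

theorem abs_real_sub_real_le_tvDist {A : Set Ω} (hA : MeasurableSet A) :
    |P.real A - Q.real A| ≤ tvDist P Q := by
  refine le_ciSup (f := fun A : {A : Set Ω // MeasurableSet A} => |P.real A - Q.real A|)
    ⟨1, ?_⟩ ⟨A, hA⟩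
  rintro _ ⟨B, rfl⟩
  exact abs_real_sub_real_le_one _

end ProbabilityMeasure

theorem integral_abs_one_sub_le_sqrt [IsProbabilityMeasure P] {F : Ω → ℝ} (hF : MemLp F 2 P) :
    ∫ x, |1 - F x| ∂P ≤ √(∫ x, F x ^ 2 ∂P - 2 * ∫ x, F x ∂P + 1) := by
  have hFi : Integrable F P := hF.integrable one_le_two
  have hsq : ∫ x, |1 - F x| ^ 2 ∂P = ∫ x, F x ^ 2 ∂P - 2 * ∫ x, F x ∂P + 1 := by
    have hexpand : ∀ x, |1 - F x| ^ 2 = F x ^ 2 - 2 * F x + 1 := fun x => by rw [sq_abs]; ring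
    simp_rw [hexpand]
    rw [integral_add (f := fun x => F x ^ 2 - 2 * F x)
        (hF.integrable_sq.sub (hFi.const_mul 2)) (integrable_const _),
      integral_sub hF.integrable_sq (hFi.const_mul 2), integral_const_mul]
    simp
  have hmem : MemLp (fun x => |1 - F x|) 2 P := ((memLp_const (1 : ℝ)).sub hF).norm
  have hvar := variance_nonneg (fun x => |1 - F x|) P
  rw [variance_eq_sub hmem] at hvar
  apply Real.le_sqrt_of_sq_le
  rw [← hsq]
  exact sub_nonneg.1 hvar

theorem withDensity_ofReal_real_apply {L : Ω → ℝ} (hL0 : ∀ x, 0 ≤ L x) (hL : Integrable L P)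
    {A : Set Ω} (hA : MeasurableSet A) :
    (P.withDensity fun x => ENNReal.ofReal (L x)).real A = ∫ x in A, L x ∂P := by
  rw [measureReal_def, withDensity_apply _ hA,
    ← ofReal_integral_eq_lintegral_ofReal hL.integrableOn (ae_of_all _ hL0),
    ENNReal.toReal_ofReal (integral_nonneg hL0)]

theorem tvDist_le_of_eq_withDensity [IsProbabilityMeasure P] [IsProbabilityMeasure Q] {L : Ω → ℝ}
    (hL0 : ∀ x, 0 ≤ L x) (hL : Integrable L P)
    (hQ : Q = P.withDensity fun x => ENNReal.ofReal (L x)) {S : Set Ω} (hS : MeasurableSet S)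
    (hL2 : IntegrableOn (fun x => L x ^ 2) S P) :
    tvDist P Q ≤ (1 - Q.real S) + √(∫ x in S, L x ^ 2 ∂P - 2 * Q.real S + 1) := by
  have hQA {A : Set Ω} (hA : MeasurableSet A) : Q.real A = ∫ x in A, L x ∂P := by
    rw [hQ, withDensity_ofReal_real_apply hL0 hL hA]
  have hsq : (fun x => S.indicator L x ^ 2) = S.indicator fun x => L x ^ 2 := by
    ext x
    by_cases hx : x ∈ S <;> simp [hx]
  have hF : MemLp (S.indicator L) 2 P := by
    rw [memLp_two_iff_integrable_sq (hL.indicator hS).aestronglyMeasurable, hsq]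
    exact hL2.integrable_indicator hS
  have hL1 := integral_abs_one_sub_le_sqrt hF
  rw [hsq, integral_indicator hS, integral_indicator hS, ← hQA hS] at hL1
  refine tvDist_le fun A hA => ?_
  have hinter : |P.real A - Q.real (A ∩ S)| ≤ ∫ x, |1 - S.indicator L x| ∂P := by
    have hdiff : P.real A - Q.real (A ∩ S) = ∫ x in A, (1 - S.indicator L x) ∂P := by
      rw [integral_sub (integrable_const _).integrableOn (hL.indicator hS).integrableOn,
        setIntegral_indicator hS, hQA (hA.inter hS)]
      simp
    rw [hdiff]
    exact abs_integral_le_integral_abs.trans (setIntegral_le_integral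
      ((integrable_const _).sub (hL.indicator hS)).abs (ae_of_all _ fun _ => abs_nonneg _))
  have hcompl : Q.real (A \ S) ≤ 1 - Q.real S := by
    rw [← probReal_compl_eq_one_sub hS]
    exact measureReal_mono fun x hx => hx.2
  have hcompl_nonneg : 0 ≤ Q.real (A \ S) := measureReal_nonneg
  rw [← measureReal_inter_add_sdiff (μ := Q) (s := A) hS]
  rw [abs_le] at hinter ⊢
  constructor <;> linarith [hinter.1, hinter.2]

end TotalVariation

section Product

theorem pi_withDensity_ofReal {ι : Type*} [Fintype ι] {α : ι → Type*}
    [∀ i, MeasurableSpace (α i)] {P : ∀ i, Measure (α i)} [∀ i, SigmaFinite (P i)]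
    {L : ∀ i, α i → ℝ} (hL0 : ∀ i x, 0 ≤ L i x) (hL : ∀ i, Integrable (L i) (P i)) :
    (Measure.pi fun i => (P i).withDensity fun x => ENNReal.ofReal (L i x)) =
      (Measure.pi P).withDensity fun x => ENNReal.ofReal (∏ i, L i (x i)) := by
  refine Measure.pi_eq fun s hs => ?_
  rw [withDensity_apply _ (MeasurableSet.univ_pi hs), ← ofReal_integral_eq_lintegral_ofReal
    (Integrable.fintype_prod_dep hL).integrableOn
      (ae_of_all _ fun x => Finset.prod_nonneg fun i _ => hL0 i _),
    Measure.restrict_pi_pi, integral_fintype_prod_eq_prod,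
    ENNReal.ofReal_prod_of_nonneg fun i _ => integral_nonneg (hL0 i)]
  refine Finset.prod_congr rfl fun i _ => ?_
  rw [withDensity_apply _ (hs i), ofReal_integral_eq_lintegral_ofReal (hL i).integrableOn
    (ae_of_all _ (hL0 i))]

theorem tvDist_pi_le_of_eq_withDensity {α : Type*} [MeasurableSpace α] {P Q : Measure α}
    [IsProbabilityMeasure P] [IsProbabilityMeasure Q] {L : α → ℝ} (hL0 : ∀ x, 0 ≤ L x)
    (hL : Integrable L P) (hQ : Q = P.withDensity fun x => ENNReal.ofReal (L x)) {B : Set α}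
    (hB : MeasurableSet B) (hL2 : IntegrableOn (fun x => L x ^ 2) B P) (n : ℕ) :
    tvDist (Measure.pi fun _ : Fin n => P) (Measure.pi fun _ : Fin n => Q) ≤
      (1 - Q.real B ^ n) + √((∫ x in B, L x ^ 2 ∂P) ^ n - 2 * Q.real B ^ n + 1) := by
  have hbox : (Measure.pi fun _ : Fin n => P).restrict (Set.univ.pi fun _ => B) =
      Measure.pi fun _ => P.restrict B := Measure.restrict_pi_pi _ _
  have hpi : (Measure.pi fun _ : Fin n => Q) = (Measure.pi fun _ => P).withDensity
      fun x => ENNReal.ofReal (∏ i, L (x i)) := by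
    rw [hQ, pi_withDensity_ofReal (fun _ => hL0) fun _ => hL]
  have hL2box : IntegrableOn (fun x : Fin n → α => (∏ i, L (x i)) ^ 2)
      (Set.univ.pi fun _ => B) (Measure.pi fun _ => P) := by
    simp_rw [IntegrableOn, hbox, ← Finset.prod_pow]
    exact Integrable.fintype_prod (f := fun _ x => L x ^ 2) fun _ => hL2
  have hsq : ∫ x in Set.univ.pi fun _ : Fin n => B, (∏ i, L (x i)) ^ 2 ∂(Measure.pi fun _ => P) =
      (∫ x in B, L x ^ 2 ∂P) ^ n := by
    simp_rw [hbox, ← Finset.prod_pow]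
    rw [integral_fintype_prod_eq_pow (fun x => L x ^ 2), Fintype.card_fin]
  have hQbox : (Measure.pi fun _ : Fin n => Q).real (Set.univ.pi fun _ => B) = Q.real B ^ n := by
    simp [measureReal_def, Measure.pi_pi]
  have hmain := tvDist_le_of_eq_withDensity
    (fun x : Fin n → α => Finset.prod_nonneg fun i _ => hL0 (x i))
    (Integrable.fintype_prod fun _ => hL) hpi (MeasurableSet.univ_pi fun _ => hB) hL2box
  rwa [hsq, hQbox] at hmain

end Product

section Gaussian

theorem measurableSet_setOf_lt_abs (t : ℝ) : MeasurableSet {x : ℝ | t < |x|} :=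
  measurableSet_lt measurable_const measurable_abs

theorem gaussianPDFReal_zero_one (x : ℝ) :
    gaussianPDFReal 0 1 x = (√(2 * Real.pi))⁻¹ * Real.exp (-x ^ 2 / 2) := by
  simp [gaussianPDFReal]

theorem inv_sqrt_two_pi_le_one : (√(2 * Real.pi))⁻¹ ≤ 1 :=
  inv_le_one_of_one_le₀ (Real.one_le_sqrt.2 (by linarith [Real.pi_gt_three]))

theorem gaussianReal_real_eq_setIntegral (A : Set ℝ) :
    (gaussianReal 0 1).real A = ∫ x in A, gaussianPDFReal 0 1 x := by
  rw [measureReal_def, gaussianReal_apply_eq_integral _ one_ne_zero,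
    ENNReal.toReal_ofReal (integral_nonneg fun _ => gaussianPDFReal_nonneg _ _ _)]

theorem gaussianReal_eq_withDensity_standard (m : ℝ) :
    gaussianReal m 1 = (gaussianReal 0 1).withDensity
      fun x => ENNReal.ofReal (Real.exp (m * x - m ^ 2 / 2)) := by
  rw [gaussianReal_of_var_ne_zero _ one_ne_zero, gaussianReal_of_var_ne_zero _ one_ne_zero,
    ← withDensity_mul _ (measurable_gaussianPDF 0 1) (by fun_prop)]
  congr 1
  ext x
  simp only [Pi.mul_apply, gaussianPDF, gaussianPDFReal]
  rw [← ENNReal.ofReal_mul (by positivity), mul_assoc (√_)⁻¹, ← Real.exp_add]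
  congr 3
  push_cast
  ring

theorem gaussianReal_lt_abs_le_add (m t : ℝ) :
    (gaussianReal m 1).real {x | t < |x|} ≤
      (gaussianReal m 1).real (Set.Ioi t) + (gaussianReal (-m) 1).real (Set.Ioi t) := by
  have hsub : {x : ℝ | t < |x|} ⊆ Set.Ioi t ∪ (fun x => -x) ⁻¹' Set.Ioi t :=
    fun x hx => lt_abs.1 (show t < |x| from hx)
  rw [← gaussianReal_map_neg, map_measureReal_apply measurable_neg measurableSet_Ioi]
  exact (measureReal_mono hsub).trans (measureReal_union_le _ _)

theorem gaussianReal_Ioi_le_exp {m t : ℝ} (ht : m ≤ t) :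
    (gaussianReal m 1).real (Set.Ioi t) ≤ Real.exp (-(t - m) ^ 2 / 2) := by
  have hchernoff := measure_ge_le_exp_mul_mgf (μ := gaussianReal m 1) (X := id) t (sub_nonneg.2 ht)
    (integrable_exp_mul_gaussianReal (t - m))
  rw [mgf_id_gaussianReal, ← Real.exp_add] at hchernoff
  refine (measureReal_mono Set.Ioi_subset_Ici_self).trans (hchernoff.trans_eq ?_)
  congr 1
  push_cast
  ring

theorem gaussianReal_lt_abs_le (m t : ℝ) :
    (gaussianReal m 1).real {x | t < |x|} ≤ 2 * Real.exp (-(max (t - |m|) 0) ^ 2 / 2) := by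
  rcases le_total t |m| with htm | htm
  · rw [max_eq_right (sub_nonpos.2 htm), zero_pow two_ne_zero, neg_zero, zero_div, Real.exp_zero]
    linarith [measureReal_le_one (μ := gaussianReal m 1) (s := {x | t < |x|})]
  rw [max_eq_left (sub_nonneg.2 htm)]
  have hone_side {m' : ℝ} (hm' : m' ≤ |m|) :
      (gaussianReal m' 1).real (Set.Ioi t) ≤ Real.exp (-(t - |m|) ^ 2 / 2) := by
    refine (gaussianReal_Ioi_le_exp (hm'.trans htm)).trans (Real.exp_le_exp.2 ?_)
    have := pow_le_pow_left₀ (sub_nonneg.2 htm) (sub_le_sub_left hm' t) 2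
    linarith
  linarith [gaussianReal_lt_abs_le_add m t, hone_side (le_abs_self m), hone_side (neg_le_abs m)]

theorem gaussianReal_Ioi_le_exp_div {t : ℝ} (ht : 0 < t) :
    (gaussianReal 0 1).real (Set.Ioi t) ≤ Real.exp (-t ^ 2 / 2) / t := by
  rw [gaussianReal_real_eq_setIntegral]
  calc ∫ x in Set.Ioi t, gaussianPDFReal 0 1 x
      ≤ ∫ x in Set.Ioi t, Real.exp (t ^ 2 / 2) * Real.exp (-t * x) := by
        refine integral_mono (integrable_gaussianPDFReal 0 1).integrableOn
          ((integrableOn_exp_mul_Ioi (neg_lt_zero.2 ht) t).const_mul _) fun x => ?_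
        simp only [gaussianPDFReal_zero_one, ← Real.exp_add]
        refine (mul_le_of_le_one_left (Real.exp_pos _).le inv_sqrt_two_pi_le_one).trans ?_
        apply Real.exp_le_exp.2
        nlinarith [sq_nonneg (x - t)]
    _ = Real.exp (-t ^ 2 / 2) / t := by
        rw [integral_const_mul, integral_exp_mul_Ioi (neg_lt_zero.2 ht), neg_div_neg_eq,
          mul_div_assoc', ← Real.exp_add]
        congr 2
        ring

theorem gaussianReal_standard_lt_abs_le {t : ℝ} (ht : 0 < t) :
    (gaussianReal 0 1).real {x | t < |x|} ≤ 2 * (Real.exp (-t ^ 2 / 2) / t) := by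
  have hadd := gaussianReal_lt_abs_le_add 0 t
  rw [neg_zero] at hadd
  linarith [gaussianReal_Ioi_le_exp_div ht]

theorem le_gaussianReal_Ioi {s : ℝ} (hs : 0 ≤ s) :
    (√(2 * Real.pi))⁻¹ * Real.exp (-(s + 1) ^ 2 / 2) ≤ (gaussianReal 0 1).real (Set.Ioi s) := by
  refine le_trans ?_ (measureReal_mono (s₁ := Set.Ioc s (s + 1)) fun x hx => hx.1)
  rw [gaussianReal_real_eq_setIntegral]
  calc (√(2 * Real.pi))⁻¹ * Real.exp (-(s + 1) ^ 2 / 2)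
      = ∫ x in Set.Ioc s (s + 1), (√(2 * Real.pi))⁻¹ * Real.exp (-(s + 1) ^ 2 / 2) := by simp
    _ ≤ ∫ x in Set.Ioc s (s + 1), gaussianPDFReal 0 1 x := by
      refine setIntegral_mono_on (integrableOn_const (by simp))
        (integrable_gaussianPDFReal 0 1).integrableOn measurableSet_Ioc fun x hx => ?_
      rw [gaussianPDFReal_zero_one]
      gcongr
      · linarith [hx.1]
      · exact hx.2

end Gaussian

section Convolution

/-- The probability `P(|μ + Z| > t)` that one observation with mean `μ ∼ H` and standard normal
noise `Z` exceeds the level `t` in absolute value. -/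
noncomputable def exceedanceProb (H : Measure ℝ) (t : ℝ) : ℝ :=
  (Measure.conv H (gaussianReal 0 1)).real {y | t < |y|}

/-- The likelihood ratio of the Gaussian convolution `H * Φ` with respect to `Φ`. -/
noncomputable def likelihoodRatio (H : Measure ℝ) (x : ℝ) : ℝ :=
  ∫ m, Real.exp (m * x - m ^ 2 / 2) ∂H

/-- The tail probability of `|μ|`, `μ ∼ H`, smoothed at the Gaussian scale: the mean of
`exp (-(y - |μ|)₊² / 2)`. It controls both the exceedance probability at `y` and the likelihood
ratio at `±y`. -/
noncomputable def smoothedTail (H : Measure ℝ) (y : ℝ) : ℝ :=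
  ∫ m, Real.exp (-(max (y - |m|) 0) ^ 2 / 2) ∂H

variable (H : Measure ℝ)

theorem likelihoodRatio_nonneg (x : ℝ) : 0 ≤ likelihoodRatio H x :=
  integral_nonneg fun _ => (Real.exp_pos _).le

theorem conv_gaussianReal_apply {A : Set ℝ} (hA : MeasurableSet A) :
    Measure.conv H (gaussianReal 0 1) A = ∫⁻ m, gaussianReal m 1 A ∂H := by
  rw [Measure.conv, Measure.map_apply (by fun_prop) hA, Measure.prod_apply (measurable_add hA)]
  refine lintegral_congr fun m => ?_
  have hshift := gaussianReal_map_const_add (μ := 0) (v := 1) m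
  rw [zero_add] at hshift
  rw [← hshift, Measure.map_apply (by fun_prop) hA]
  rfl

variable [IsProbabilityMeasure H]

theorem integrable_likelihoodRatio_integrand (x : ℝ) :
    Integrable (fun m => Real.exp (m * x - m ^ 2 / 2)) H := by
  refine Integrable.of_bound (by fun_prop) (Real.exp (x ^ 2 / 2)) (ae_of_all _ fun m => ?_)
  rw [Real.norm_of_nonneg (Real.exp_pos _).le]
  apply Real.exp_le_exp.2
  nlinarith [sq_nonneg (x - m)]

theorem integrable_smoothedTail_integrand (y : ℝ) :
    Integrable (fun m => Real.exp (-(max (y - |m|) 0) ^ 2 / 2)) H := by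
  refine Integrable.of_bound (by fun_prop) 1 (ae_of_all _ fun m => ?_)
  rw [Real.norm_of_nonneg (Real.exp_pos _).le]
  apply Real.exp_le_one_iff.2
  linarith [sq_nonneg (max (y - |m|) 0)]

theorem measurable_likelihoodRatio : Measurable (likelihoodRatio H) :=
  (StronglyMeasurable.integral_prod_right' (f := fun z : ℝ × ℝ =>
    Real.exp (z.2 * z.1 - z.2 ^ 2 / 2)) (by fun_prop)).measurable

theorem conv_gaussianReal_eq_withDensity :
    Measure.conv H (gaussianReal 0 1) =
      (gaussianReal 0 1).withDensity fun x => ENNReal.ofReal (likelihoodRatio H x) := by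
  have hlint (x : ℝ) : ENNReal.ofReal (likelihoodRatio H x) =
      ∫⁻ m, ENNReal.ofReal (Real.exp (m * x - m ^ 2 / 2)) ∂H :=
    ofReal_integral_eq_lintegral_ofReal (integrable_likelihoodRatio_integrand H x)
      (ae_of_all _ fun _ => (Real.exp_pos _).le)
  ext A hA
  rw [conv_gaussianReal_apply H hA, withDensity_apply _ hA]
  simp_rw [hlint]
  rw [lintegral_lintegral_swap (by fun_prop)]
  refine lintegral_congr fun m => ?_
  rw [gaussianReal_eq_withDensity_standard, withDensity_apply _ hA]

theorem mul_le_exceedanceProb {a s t : ℝ} (h : t ≤ a + s) :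
    H.real (Set.Ioi a) * (gaussianReal 0 1).real (Set.Ioi s) ≤ exceedanceProb H t := by
  rw [exceedanceProb, ← measureReal_prod_prod, Measure.conv,
    map_measureReal_apply (by fun_prop) (measurableSet_setOf_lt_abs t)]
  refine measureReal_mono fun z ⟨hz₁, hz₂⟩ => ?_
  exact lt_of_lt_of_le (h.trans_lt (add_lt_add hz₁ hz₂)) (le_abs_self _)

theorem exceedanceProb_le_two_mul_smoothedTail (t : ℝ) :
    exceedanceProb H t ≤ 2 * smoothedTail H t := by
  have hA := measurableSet_setOf_lt_abs t
  rw [exceedanceProb, measureReal_def, conv_gaussianReal_apply H hA, smoothedTail,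
    ← integral_const_mul]
  refine ENNReal.toReal_le_of_le_ofReal
    (integral_nonneg fun _ => by positivity) ?_
  rw [ofReal_integral_eq_lintegral_ofReal ((integrable_smoothedTail_integrand H t).const_mul 2)
    (ae_of_all _ fun _ => by positivity)]
  refine lintegral_mono fun m => ?_
  rw [← ENNReal.ofReal_toReal (measure_ne_top (gaussianReal m 1) _)]
  exact ENNReal.ofReal_le_ofReal (gaussianReal_lt_abs_le m t)

theorem likelihoodRatio_le (x : ℝ) :
    likelihoodRatio H x ≤ Real.exp (x ^ 2 / 2) * smoothedTail H |x| := by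
  rw [likelihoodRatio, smoothedTail, ← integral_const_mul]
  refine integral_mono (integrable_likelihoodRatio_integrand H x)
    ((integrable_smoothedTail_integrand H |x|).const_mul _) fun m => ?_
  rw [← Real.exp_add]
  apply Real.exp_le_exp.2
  have hmax : max (|x| - |m|) 0 ^ 2 ≤ (x - m) ^ 2 := by
    rw [sq_le_sq, abs_of_nonneg (le_max_right _ _)]
    exact max_le (abs_sub_abs_le_abs_sub x m) (abs_nonneg _)
  linarith

theorem smoothedTail_le_mgf {l : ℝ} (hl : 0 ≤ l)
    (hint : Integrable (fun m => Real.exp (l * |m|)) H) (y : ℝ) :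
    smoothedTail H y ≤ Real.exp (-l * y + l ^ 2 / 2) * mgf (fun m => |m|) H l := by
  rw [smoothedTail, mgf, ← integral_const_mul]
  refine integral_mono (integrable_smoothedTail_integrand H y) (hint.const_mul _) fun m => ?_
  rw [← Real.exp_add]
  apply Real.exp_le_exp.2
  have hmul := mul_le_mul_of_nonneg_left (le_max_left (y - |m|) 0) hl
  linarith [sq_nonneg (max (y - |m|) 0 - l)]

theorem smoothedTail_le_add_real (a y : ℝ) :
    smoothedTail H y ≤ Real.exp (-(max (y - a) 0) ^ 2 / 2) + H.real {m | a < |m|} := by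
  have hA := measurableSet_setOf_lt_abs a
  have hind : Integrable ({m : ℝ | a < |m|}.indicator fun _ => (1 : ℝ)) H :=
    (integrable_const 1).indicator hA
  have hsum : Real.exp (-(max (y - a) 0) ^ 2 / 2) + H.real {m | a < |m|} =
      ∫ m, (Real.exp (-(max (y - a) 0) ^ 2 / 2) +
        {m : ℝ | a < |m|}.indicator (fun _ => 1) m) ∂H := by
    rw [integral_add (integrable_const _) hind, integral_indicator hA]
    simp
  rw [hsum, smoothedTail]
  refine integral_mono (integrable_smoothedTail_integrand H y)
    ((integrable_const _).add hind) fun m => ?_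
  by_cases hm : a < |m|
  · have : Real.exp (-(max (y - |m|) 0) ^ 2 / 2) ≤ 1 :=
      Real.exp_le_one_iff.2 (by linarith [sq_nonneg (max (y - |m|) 0)])
    simp only [Set.indicator_of_mem (show m ∈ {m : ℝ | a < |m|} from hm)]
    linarith [Real.exp_pos (-(max (y - a) 0) ^ 2 / 2)]
  · rw [Set.indicator_of_notMem (show m ∉ {m : ℝ | a < |m|} from hm), add_zero]
    gcongr
    exact not_lt.1 hm

end Convolution

section Threshold

/-- The level `√(2 log n)` at which the maximum of `n` standard normal variables concentrates. -/
noncomputable def sqrtTwoLog (n : ℕ) : ℝ := √(2 * Real.log n)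

theorem sqrtTwoLog_nonneg (n : ℕ) : 0 ≤ sqrtTwoLog n := Real.sqrt_nonneg _

theorem sqrtTwoLog_sq (n : ℕ) : sqrtTwoLog n ^ 2 = 2 * Real.log n :=
  Real.sq_sqrt (mul_nonneg two_pos.le (Real.log_natCast_nonneg n))

theorem tendsto_sqrtTwoLog : Tendsto sqrtTwoLog atTop atTop :=
  Real.tendsto_sqrt_atTop.comp
    ((Real.tendsto_log_atTop.comp tendsto_natCast_atTop_atTop).const_mul_atTop two_pos)

theorem natCast_rpow_eq_exp {n : ℕ} (hn : 1 ≤ n) (c : ℝ) :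
    (n : ℝ) ^ c = Real.exp (c * sqrtTwoLog n ^ 2 / 2) := by
  rw [sqrtTwoLog_sq, Real.rpow_def_of_pos (by exact_mod_cast hn)]
  congr 1
  ring

theorem tendsto_natCast_rpow_atTop {c : ℝ} (hc : 0 < c) :
    Tendsto (fun n : ℕ => (n : ℝ) ^ c) atTop atTop :=
  (tendsto_rpow_atTop hc).comp tendsto_natCast_atTop_atTop

theorem eventually_mul_exp_le_natCast_rpow (C K a : ℝ) {ε : ℝ} (hε : 0 < ε) :
    ∀ᶠ n : ℕ in atTop,
      C * Real.exp (a * sqrtTwoLog n ^ 2 / 2 + K * sqrtTwoLog n) ≤ (n : ℝ) ^ (a + ε) := by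
  have hquad : Tendsto (fun t : ℝ => t * (ε / 2 * t + -K)) atTop atTop :=
    tendsto_id.atTop_mul_atTop₀
      (tendsto_atTop_add_const_right _ _ (tendsto_id.const_mul_atTop (half_pos hε)))
  filter_upwards [eventually_ge_atTop 1, (Real.tendsto_exp_atTop.comp
    (hquad.comp tendsto_sqrtTwoLog)).eventually_ge_atTop C] with n hn hC
  calc C * Real.exp (a * sqrtTwoLog n ^ 2 / 2 + K * sqrtTwoLog n)
      ≤ Real.exp (sqrtTwoLog n * (ε / 2 * sqrtTwoLog n + -K)) *
          Real.exp (a * sqrtTwoLog n ^ 2 / 2 + K * sqrtTwoLog n) := by gcongr; exact hC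
    _ = (n : ℝ) ^ (a + ε) := by
      rw [natCast_rpow_eq_exp hn, ← Real.exp_add]
      congr 1
      ring

theorem eventually_natCast_rpow_le_mul_exp {c : ℝ} (hc : 0 < c) (K a : ℝ) {ε : ℝ} (hε : 0 < ε) :
    ∀ᶠ n : ℕ in atTop,
      (n : ℝ) ^ (a - ε) ≤ c * Real.exp (a * sqrtTwoLog n ^ 2 / 2 - K * sqrtTwoLog n) := by
  filter_upwards [eventually_mul_exp_le_natCast_rpow c⁻¹ K (-a) hε] with n hn
  calc (n : ℝ) ^ (a - ε) = ((n : ℝ) ^ (-a + ε))⁻¹ := by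
        rw [← Real.rpow_neg n.cast_nonneg]
        congr 1
        ring
    _ ≤ (c⁻¹ * Real.exp (-a * sqrtTwoLog n ^ 2 / 2 + K * sqrtTwoLog n))⁻¹ :=
        inv_anti₀ (by positivity) hn
    _ = c * Real.exp (a * sqrtTwoLog n ^ 2 / 2 - K * sqrtTwoLog n) := by
        rw [mul_inv, inv_inv, ← Real.exp_neg]
        congr 2
        ring

end Threshold

section Mixture

variable (H : Measure ℝ) [IsProbabilityMeasure H] {p : ℝ}

theorem mixtureLaw_real_apply (h0 : 0 ≤ p) (h1 : p ≤ 1) (A : Set ℝ) :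
    (mixtureLaw p H).real A = (1 - p) * (gaussianReal 0 1).real A +
      p * (Measure.conv H (gaussianReal 0 1)).real A := by
  rw [mixtureLaw, measureReal_add_apply
    (ENNReal.mul_ne_top ENNReal.ofReal_ne_top (measure_ne_top _ _))
    (ENNReal.mul_ne_top ENNReal.ofReal_ne_top (measure_ne_top _ _)), measureReal_ennreal_smul_apply,
    measureReal_ennreal_smul_apply, ENNReal.toReal_ofReal h0,
    ENNReal.toReal_ofReal (sub_nonneg.2 h1)]

theorem isProbabilityMeasure_mixtureLaw (h0 : 0 ≤ p) (h1 : p ≤ 1) :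
    IsProbabilityMeasure (mixtureLaw p H) := by
  constructor
  rw [mixtureLaw, Measure.add_apply, Measure.smul_apply, Measure.smul_apply, measure_univ,
    measure_univ, smul_eq_mul, smul_eq_mul, mul_one, mul_one,
    ← ENNReal.ofReal_add (sub_nonneg.2 h1) h0, sub_add_cancel, ENNReal.ofReal_one]

theorem mul_exceedanceProb_le_mixtureLaw (h0 : 0 ≤ p) (h1 : p ≤ 1) (t : ℝ) :
    p * exceedanceProb H t ≤ (mixtureLaw p H).real {y | t < |y|} := by
  rw [mixtureLaw_real_apply H h0 h1]
  exact le_add_of_nonneg_left (mul_nonneg (sub_nonneg.2 h1) measureReal_nonneg)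

theorem mixtureLaw_lt_abs_le (h0 : 0 ≤ p) (h1 : p ≤ 1) (t : ℝ) :
    (mixtureLaw p H).real {y | t < |y|} ≤
      (gaussianReal 0 1).real {y | t < |y|} + p * exceedanceProb H t := by
  rw [mixtureLaw_real_apply H h0 h1]
  gcongr
  · exact mul_le_of_le_one_left measureReal_nonneg (sub_le_self 1 h0)
  · rfl

theorem mixtureLaw_eq_withDensity (h0 : 0 ≤ p) (h1 : p ≤ 1) :
    mixtureLaw p H = (gaussianReal 0 1).withDensity
      fun x => ENNReal.ofReal (1 - p + p * likelihoodRatio H x) := by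
  have hdens : (fun x => ENNReal.ofReal (1 - p + p * likelihoodRatio H x)) =
      (fun _ => ENNReal.ofReal (1 - p)) +
        ENNReal.ofReal p • fun x => ENNReal.ofReal (likelihoodRatio H x) := by
    ext x
    rw [ENNReal.ofReal_add (sub_nonneg.2 h1) (mul_nonneg h0 (likelihoodRatio_nonneg H x)),
      ENNReal.ofReal_mul h0]
    rfl
  rw [hdens, withDensity_add_left measurable_const, withDensity_const,
    withDensity_smul _ (measurable_likelihoodRatio H).ennreal_ofReal,
    ← conv_gaussianReal_eq_withDensity, mixtureLaw]

end Mixture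

section MaxTest

theorem setOf_forall_abs_le (n : ℕ) (s : ℝ) :
    {x : Fin n → ℝ | ∀ i, |x i| ≤ s} = Set.univ.pi fun _ => {y : ℝ | s < |y|}ᶜ := by
  ext x
  simp

theorem measurableSet_forall_abs_le (n : ℕ) (s : ℝ) :
    MeasurableSet {x : Fin n → ℝ | ∀ i, |x i| ≤ s} := by
  rw [setOf_forall_abs_le]
  exact MeasurableSet.univ_pi fun _ => (measurableSet_setOf_lt_abs s).compl

theorem pi_real_forall_abs_le (Q : Measure ℝ) [IsProbabilityMeasure Q] (n : ℕ) (s : ℝ) :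
    (Measure.pi fun _ : Fin n => Q).real {x | ∀ i, |x i| ≤ s} = (1 - Q.real {y | s < |y|}) ^ n := by
  rw [setOf_forall_abs_le, measureReal_def, Measure.pi_pi, ENNReal.toReal_prod,
    ← probReal_compl_eq_one_sub (measurableSet_setOf_lt_abs s)]
  simp [measureReal_def]

theorem one_sub_mul_le_one_sub_pow {x : ℝ} (hx : x ≤ 1) (n : ℕ) : 1 - n * x ≤ (1 - x) ^ n := by
  have hbernoulli := one_add_mul_le_pow (a := -x) (by linarith) n
  rw [← sub_eq_add_neg] at hbernoulli
  linarith

instance (n : ℕ) : IsProbabilityMeasure (nullLaw n) := by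
  unfold nullLaw
  infer_instance

theorem natCast_mul_gaussianReal_lt_abs_le {n : ℕ} (hn : 1 ≤ n) (ht : 0 < sqrtTwoLog n) :
    n * (gaussianReal 0 1).real {y | sqrtTwoLog n < |y|} ≤ 2 / sqrtTwoLog n := by
  have hexp : Real.exp (-sqrtTwoLog n ^ 2 / 2) = (n : ℝ)⁻¹ := by
    rw [← Real.rpow_neg_one, natCast_rpow_eq_exp hn, neg_one_mul]
  have hn0 : (n : ℝ) ≠ 0 := by positivity
  calc n * (gaussianReal 0 1).real {y | sqrtTwoLog n < |y|}
      ≤ n * (2 * (Real.exp (-sqrtTwoLog n ^ 2 / 2) / sqrtTwoLog n)) := by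
        gcongr
        exact gaussianReal_standard_lt_abs_le ht
    _ = 2 / sqrtTwoLog n := by
        rw [hexp]
        field_simp

theorem tendsto_nullLaw_forall_abs_le :
    Tendsto (fun n : ℕ => (nullLaw n).real {x | ∀ i, |x i| ≤ sqrtTwoLog n}) atTop (𝓝 1) := by
  have hlim : Tendsto (fun n : ℕ => 1 - 2 / sqrtTwoLog n) atTop (𝓝 1) := by
    simpa only [sub_zero] using (tendsto_sqrtTwoLog.const_div_atTop 2).const_sub 1
  refine tendsto_of_tendsto_of_tendsto_of_le_of_le' hlim tendsto_const_nhds ?_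
    (Eventually.of_forall fun n => measureReal_le_one)
  filter_upwards [eventually_ge_atTop 1, tendsto_sqrtTwoLog.eventually_gt_atTop 0] with n hn ht
  rw [nullLaw, pi_real_forall_abs_le]
  refine le_trans ?_ (one_sub_mul_le_one_sub_pow measureReal_le_one n)
  linarith [natCast_mul_gaussianReal_lt_abs_le hn ht]

theorem eventually_maxThreshold_le {α : ℝ} (h0 : 0 < α) (h1 : α < 1) :
    ∀ᶠ n : ℕ in atTop, maxThreshold n α ≤ sqrtTwoLog n := by
  filter_upwards [tendsto_nullLaw_forall_abs_le.eventually_const_le (sub_lt_self 1 h0),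
    eventually_ge_atTop 1] with n hn hn1
  refine csInf_le ⟨0, fun s hs => ?_⟩ hn
  by_contra! hneg
  have hempty : {x : Fin n → ℝ | ∀ i, |x i| ≤ s} = ∅ :=
    Set.eq_empty_of_forall_notMem fun x hx =>
      ((hx ⟨0, hn1⟩).trans_lt hneg).not_ge (abs_nonneg _)
  have hs' : 1 - α ≤ (nullLaw n).real {x | ∀ i, |x i| ≤ s} := hs
  rw [hempty, measureReal_empty] at hs'
  linarith

variable {G : ℕ → Measure ℝ} [∀ n, IsProbabilityMeasure (G n)] {b β : ℝ}

theorem natCast_rpow_neg_le_one {n : ℕ} (hn : 1 ≤ n) (hβ : 0 ≤ β) : (n : ℝ) ^ (-β) ≤ 1 :=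
  Real.rpow_le_one_of_one_le_of_nonpos (by exact_mod_cast hn) (neg_nonpos.2 hβ)

theorem isProbabilityMeasure_altLaw {n : ℕ} (hn : 1 ≤ n) (hβ : 0 ≤ β) :
    IsProbabilityMeasure (altLaw G β n) := by
  have := isProbabilityMeasure_mixtureLaw (G n) (p := (n : ℝ) ^ (-β)) (by positivity)
    (natCast_rpow_neg_le_one hn hβ)
  unfold altLaw
  infer_instance

theorem altLaw_forall_abs_le_le_exp {n : ℕ} (hn : 1 ≤ n) (hβ : 0 ≤ β) (t : ℝ) :
    (altLaw G β n).real {x | ∀ i, |x i| ≤ t} ≤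
      Real.exp (-(n * ((n : ℝ) ^ (-β) * exceedanceProb (G n) t))) := by
  have hp0 : 0 ≤ (n : ℝ) ^ (-β) := by positivity
  have hp1 : (n : ℝ) ^ (-β) ≤ 1 := natCast_rpow_neg_le_one hn hβ
  have := isProbabilityMeasure_mixtureLaw (G n) hp0 hp1
  rw [altLaw, pi_real_forall_abs_le, ← mul_neg, Real.exp_nat_mul]
  refine pow_le_pow_left₀ (sub_nonneg.2 measureReal_le_one) ?_ n
  refine (Real.one_sub_le_exp_neg _).trans (Real.exp_le_exp.2 (neg_le_neg ?_))
  exact mul_exceedanceProb_le_mixtureLaw (G n) hp0 hp1 t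

theorem tendsto_altLaw_forall_abs_le (hβ0 : 0 ≤ β) (hβ : β < b)
    (hlow : ∀ ε : ℝ, 0 < ε → ∀ᶠ n : ℕ in atTop,
      (n : ℝ) ^ (b - 1 - ε) ≤ exceedanceProb (G n) (sqrtTwoLog n)) :
    Tendsto (fun n : ℕ => (altLaw G β n).real {x | ∀ i, |x i| ≤ sqrtTwoLog n}) atTop (𝓝 0) := by
  have hε : 0 < (b - β) / 2 := half_pos (sub_pos.2 hβ)
  refine tendsto_of_tendsto_of_tendsto_of_le_of_le' tendsto_const_nhds
    (Real.tendsto_exp_neg_atTop_nhds_zero.comp (tendsto_natCast_rpow_atTop hε))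
    (Eventually.of_forall fun n => measureReal_nonneg) ?_
  filter_upwards [eventually_ge_atTop 1, hlow _ hε] with n hn hlow
  refine (altLaw_forall_abs_le_le_exp hn hβ0 _).trans (Real.exp_le_exp.2 (neg_le_neg ?_))
  have hn0 : (0 : ℝ) < n := by exact_mod_cast hn
  calc (n : ℝ) ^ ((b - β) / 2) = n * ((n : ℝ) ^ (-β) * (n : ℝ) ^ (b - 1 - (b - β) / 2)) := by
        rw [← Real.rpow_add hn0, ← Real.rpow_one_add' hn0.le (by linarith)]
        congr 1
        ring
    _ ≤ n * ((n : ℝ) ^ (-β) * exceedanceProb (G n) (sqrtTwoLog n)) := by gcongr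

theorem hasFullAsymptoticPower_maxTest (hβ0 : 0 ≤ β)
    (h : Tendsto (fun n : ℕ => (altLaw G β n).real {x | ∀ i, |x i| ≤ sqrtTwoLog n}) atTop (𝓝 0)) :
    HasFullAsymptoticPower maxTest G β := by
  intro α h0 h1
  have hlim := h.const_sub 1
  rw [sub_zero] at hlim
  refine tendsto_of_tendsto_of_tendsto_of_le_of_le' hlim tendsto_const_nhds ?_ ?_
  · filter_upwards [eventually_ge_atTop 1, eventually_maxThreshold_le h0 h1] with n hn hle
    have := isProbabilityMeasure_altLaw (G := G) hn hβ0
    rw [← probReal_compl_eq_one_sub (measurableSet_forall_abs_le n _)]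
    refine measureReal_mono fun x hx => ?_
    simp only [Set.mem_compl_iff, Set.mem_ofPred_eq, not_forall, not_le] at hx
    obtain ⟨i, hi⟩ := hx
    exact ⟨i, hle.trans_lt hi⟩
  · filter_upwards [eventually_ge_atTop 1] with n hn
    have := isProbabilityMeasure_altLaw (G := G) hn hβ0
    exact measureReal_le_one

theorem tendsto_tvDist_one (hβ0 : 0 ≤ β)
    (h : Tendsto (fun n : ℕ => (altLaw G β n).real {x | ∀ i, |x i| ≤ sqrtTwoLog n}) atTop (𝓝 0)) :
    Tendsto (fun n : ℕ => tvDist (nullLaw n) (altLaw G β n)) atTop (𝓝 1) := by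
  have hlim := tendsto_nullLaw_forall_abs_le.sub h
  rw [sub_zero] at hlim
  refine tendsto_of_tendsto_of_tendsto_of_le_of_le' hlim tendsto_const_nhds ?_ ?_
  · filter_upwards [eventually_ge_atTop 1] with n hn
    have := isProbabilityMeasure_altLaw (G := G) hn hβ0
    exact (le_abs_self _).trans (abs_real_sub_real_le_tvDist (measurableSet_forall_abs_le n _))
  · filter_upwards [eventually_ge_atTop 1] with n hn
    have := isProbabilityMeasure_altLaw (G := G) hn hβ0
    exact tvDist_le_one

end MaxTest

section Merging

theorem setIntegral_gaussianReal_exp_le {t : ℝ} (ht : 0 ≤ t) :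
    ∫ x in Set.Icc (-t) t, Real.exp (x ^ 2 / 2) ∂(gaussianReal 0 1) ≤ 2 * t := by
  have hdens (x : ℝ) :
      (gaussianPDF 0 1 x).toReal • Real.exp (x ^ 2 / 2) = (√(2 * Real.pi))⁻¹ := by
    rw [toReal_gaussianPDF, gaussianPDFReal_zero_one, smul_eq_mul, mul_assoc, ← Real.exp_add,
      neg_div, neg_add_cancel, Real.exp_zero, mul_one]
  rw [gaussianReal_of_var_ne_zero _ one_ne_zero, setIntegral_withDensity_eq_setIntegral_toReal_smul
    (measurable_gaussianPDF 0 1) (ae_of_all _ fun _ => gaussianPDF_lt_top) _ measurableSet_Icc]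
  simp_rw [hdens]
  rw [setIntegral_const, Real.volume_real_Icc_of_le (by linarith), smul_eq_mul]
  nlinarith [inv_sqrt_two_pi_le_one]

section SecondMoment

variable (H : Measure ℝ) [IsProbabilityMeasure H] {p t E : ℝ}

theorem integrable_likelihoodRatio : Integrable (likelihoodRatio H) (gaussianReal 0 1) := by
  refine ⟨(measurable_likelihoodRatio H).aestronglyMeasurable, ?_⟩
  rw [hasFiniteIntegral_iff_ofReal (ae_of_all _ (likelihoodRatio_nonneg H)),
    ← setLIntegral_univ, ← withDensity_apply _ MeasurableSet.univ,
    ← conv_gaussianReal_eq_withDensity]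
  exact measure_lt_top _ _

theorem setIntegral_likelihoodRatio_le_one {B : Set ℝ} (hB : MeasurableSet B) :
    ∫ x in B, likelihoodRatio H x ∂(gaussianReal 0 1) ≤ 1 := by
  rw [← withDensity_ofReal_real_apply (likelihoodRatio_nonneg H) (integrable_likelihoodRatio H) hB,
    ← conv_gaussianReal_eq_withDensity]
  exact measureReal_le_one

variable {H}

theorem likelihoodRatio_sq_le
    (hE : ∀ y ∈ Set.Icc 0 t, smoothedTail H y ≤ E * Real.exp (-y ^ 2 / 4)) {x : ℝ}
    (hx : x ∈ Set.Icc (-t) t) : likelihoodRatio H x ^ 2 ≤ E ^ 2 * Real.exp (x ^ 2 / 2) := by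
  have hle : likelihoodRatio H x ≤ E * Real.exp (x ^ 2 / 4) := by
    calc likelihoodRatio H x ≤ Real.exp (x ^ 2 / 2) * smoothedTail H |x| := likelihoodRatio_le H x
      _ ≤ Real.exp (x ^ 2 / 2) * (E * Real.exp (-|x| ^ 2 / 4)) := by
        gcongr
        exact hE _ ⟨abs_nonneg x, abs_le.2 hx⟩
      _ = E * Real.exp (x ^ 2 / 4) := by
        rw [sq_abs, mul_left_comm, ← Real.exp_add]
        congr 2
        ring
  refine (pow_le_pow_left₀ (likelihoodRatio_nonneg H x) hle 2).trans_eq ?_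
  rw [mul_pow, ← Real.exp_nat_mul]
  congr 2
  push_cast
  ring

theorem integrableOn_sq_mul_exp (E t : ℝ) :
    IntegrableOn (fun x => E ^ 2 * Real.exp (x ^ 2 / 2)) (Set.Icc (-t) t) (gaussianReal 0 1) :=
  Continuous.integrableOn_Icc (by fun_prop)

theorem integrableOn_likelihoodRatio_sq
    (hE : ∀ y ∈ Set.Icc 0 t, smoothedTail H y ≤ E * Real.exp (-y ^ 2 / 4)) :
    IntegrableOn (fun x => likelihoodRatio H x ^ 2) (Set.Icc (-t) t) (gaussianReal 0 1) := by
  refine (integrableOn_sq_mul_exp E t).mono'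
    ((measurable_likelihoodRatio H).pow_const 2).aestronglyMeasurable ?_
  filter_upwards [ae_restrict_mem measurableSet_Icc] with x hx
  rw [Real.norm_of_nonneg (sq_nonneg _)]
  exact likelihoodRatio_sq_le hE hx

theorem setIntegral_likelihoodRatio_sq_le (ht : 0 ≤ t)
    (hE : ∀ y ∈ Set.Icc 0 t, smoothedTail H y ≤ E * Real.exp (-y ^ 2 / 4)) :
    ∫ x in Set.Icc (-t) t, likelihoodRatio H x ^ 2 ∂(gaussianReal 0 1) ≤ 2 * t * E ^ 2 := by
  calc ∫ x in Set.Icc (-t) t, likelihoodRatio H x ^ 2 ∂(gaussianReal 0 1)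
      ≤ ∫ x in Set.Icc (-t) t, E ^ 2 * Real.exp (x ^ 2 / 2) ∂(gaussianReal 0 1) :=
        setIntegral_mono_on (integrableOn_likelihoodRatio_sq hE) (integrableOn_sq_mul_exp E t)
          measurableSet_Icc fun _ hx => likelihoodRatio_sq_le hE hx
    _ ≤ 2 * t * E ^ 2 := by
        rw [integral_const_mul, mul_comm]
        exact mul_le_mul_of_nonneg_right (setIntegral_gaussianReal_exp_le ht) (sq_nonneg E)

theorem integrableOn_mixture_sq {B : Set ℝ} (p : ℝ)
    (hL2 : IntegrableOn (fun x => likelihoodRatio H x ^ 2) B (gaussianReal 0 1)) :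
    IntegrableOn (fun x => (1 - p + p * likelihoodRatio H x) ^ 2) B (gaussianReal 0 1) := by
  have hL : MemLp (likelihoodRatio H) 2 ((gaussianReal 0 1).restrict B) :=
    (memLp_two_iff_integrable_sq (measurable_likelihoodRatio H).aestronglyMeasurable).2 hL2
  exact ((memLp_const (1 - p)).add (hL.const_mul p)).integrable_sq

theorem setIntegral_mixture_sq_le (h0 : 0 ≤ p) (h1 : p ≤ 1) {B : Set ℝ} (hB : MeasurableSet B)
    (hL2 : IntegrableOn (fun x => likelihoodRatio H x ^ 2) B (gaussianReal 0 1)) :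
    ∫ x in B, (1 - p + p * likelihoodRatio H x) ^ 2 ∂(gaussianReal 0 1) ≤
      1 + p ^ 2 * ∫ x in B, likelihoodRatio H x ^ 2 ∂(gaussianReal 0 1) := by
  have hexpand (x : ℝ) : (1 - p + p * likelihoodRatio H x) ^ 2 =
      (1 - p) ^ 2 + 2 * (1 - p) * p * likelihoodRatio H x + p ^ 2 * likelihoodRatio H x ^ 2 := by
    ring
  have hconst : Integrable (fun _ => (1 - p) ^ 2) ((gaussianReal 0 1).restrict B) :=
    integrable_const _
  have hlin : IntegrableOn (fun x => 2 * (1 - p) * p * likelihoodRatio H x) B (gaussianReal 0 1) :=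
    (integrable_likelihoodRatio H).integrableOn.const_mul _
  have haffine : IntegrableOn (fun x => (1 - p) ^ 2 + 2 * (1 - p) * p * likelihoodRatio H x) B
      (gaussianReal 0 1) := hconst.add hlin
  simp_rw [hexpand]
  rw [integral_add haffine (hL2.const_mul _), integral_add hconst hlin,
    integral_const_mul, integral_const_mul, setIntegral_const, smul_eq_mul]
  have hmass : (gaussianReal 0 1).real B ≤ 1 := measureReal_le_one
  have hcross : 0 ≤ 2 * (1 - p) * p :=
    mul_nonneg (mul_nonneg two_pos.le (sub_nonneg.2 h1)) h0
  nlinarith [mul_le_mul_of_nonneg_left (setIntegral_likelihoodRatio_le_one H hB) hcross,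
    mul_le_mul_of_nonneg_right hmass (sq_nonneg (1 - p))]

theorem tvDist_pi_mixtureLaw_le {δ η : ℝ} {n : ℕ} (hp0 : 0 ≤ p) (hp1 : p ≤ 1) (ht : 0 ≤ t)
    (hE : ∀ y ∈ Set.Icc 0 t, smoothedTail H y ≤ E * Real.exp (-y ^ 2 / 4))
    (hδ : n * (mixtureLaw p H).real {y | t < |y|} ≤ δ) (hη : n * (p ^ 2 * (2 * t * E ^ 2)) ≤ η) :
    tvDist (Measure.pi fun _ : Fin n => gaussianReal 0 1)
      (Measure.pi fun _ : Fin n => mixtureLaw p H) ≤ δ + √(Real.exp η - 2 * (1 - δ) + 1) := by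
  have := isProbabilityMeasure_mixtureLaw H hp0 hp1
  have hL2 := integrableOn_likelihoodRatio_sq hE
  have hL0 (x : ℝ) : 0 ≤ 1 - p + p * likelihoodRatio H x :=
    add_nonneg (sub_nonneg.2 hp1) (mul_nonneg hp0 (likelihoodRatio_nonneg H x))
  refine (tvDist_pi_le_of_eq_withDensity hL0
    ((integrable_const _).add ((integrable_likelihoodRatio H).const_mul p))
    (mixtureLaw_eq_withDensity H hp0 hp1) measurableSet_Icc
    (integrableOn_mixture_sq p hL2) n).trans ?_
  have hbox : 1 - δ ≤ (mixtureLaw p H).real (Set.Icc (-t) t) ^ n := by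
    have hcompl : Set.Icc (-t) t = {y : ℝ | t < |y|}ᶜ := by
      ext y
      simp [abs_le]
    rw [hcompl, probReal_compl_eq_one_sub (measurableSet_setOf_lt_abs t)]
    exact (sub_le_sub_left hδ 1).trans (one_sub_mul_le_one_sub_pow measureReal_le_one n)
  have hmoment : (∫ x in Set.Icc (-t) t, (1 - p + p * likelihoodRatio H x) ^ 2
      ∂(gaussianReal 0 1)) ^ n ≤ Real.exp η := by
    calc _ ≤ Real.exp (p ^ 2 * (2 * t * E ^ 2)) ^ n := by
          refine pow_le_pow_left₀ (integral_nonneg fun _ => sq_nonneg _) ?_ n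
          refine (setIntegral_mixture_sq_le hp0 hp1 measurableSet_Icc hL2).trans ?_
          have := mul_le_mul_of_nonneg_left (setIntegral_likelihoodRatio_sq_le ht hE) (sq_nonneg p)
          linarith [Real.add_one_le_exp (p ^ 2 * (2 * t * E ^ 2))]
      _ ≤ Real.exp η := by
          rw [← Real.exp_nat_mul]
          exact Real.exp_le_exp.2 hη
  gcongr
  linarith

end SecondMoment

variable {G : ℕ → Measure ℝ} [∀ n, IsProbabilityMeasure (G n)] {b β : ℝ}

theorem natCast_mul_rpow_mul_exceedanceProb_le {H : Measure ℝ} [IsProbabilityMeasure H] {n : ℕ}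
    (hn : 1 ≤ n) {ε : ℝ}
    (hJ : smoothedTail H (sqrtTwoLog n) ≤
      (n : ℝ) ^ (b - 1 / 2 + ε) * Real.exp (-sqrtTwoLog n ^ 2 / 4)) :
    n * ((n : ℝ) ^ (-β) * exceedanceProb H (sqrtTwoLog n)) ≤ 2 * (n : ℝ) ^ (b - β + ε) := by
  calc n * ((n : ℝ) ^ (-β) * exceedanceProb H (sqrtTwoLog n))
      ≤ n * ((n : ℝ) ^ (-β) * (2 * ((n : ℝ) ^ (b - 1 / 2 + ε) *
          Real.exp (-sqrtTwoLog n ^ 2 / 4)))) := by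
        gcongr
        exact (exceedanceProb_le_two_mul_smoothedTail H _).trans (by gcongr)
    _ = 2 * ((n : ℝ) ^ (1 : ℝ) * (n : ℝ) ^ (-β) * (n : ℝ) ^ (b - 1 / 2 + ε) *
          Real.exp (-sqrtTwoLog n ^ 2 / 4)) := by
        rw [Real.rpow_one]
        ring
    _ = 2 * (n : ℝ) ^ (b - β + ε) := by
        simp_rw [natCast_rpow_eq_exp hn, ← Real.exp_add]
        congr 2
        ring

theorem eventually_natCast_mul_sq_le {ε : ℝ} (hε : 0 < ε) :
    ∀ᶠ n : ℕ in atTop, n * (((n : ℝ) ^ (-β)) ^ 2 *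
      (2 * sqrtTwoLog n * ((n : ℝ) ^ (b - 1 / 2 + ε)) ^ 2)) ≤
        (n : ℝ) ^ (2 * (b - β) + 3 * ε) := by
  filter_upwards [eventually_ge_atTop 1, eventually_mul_exp_le_natCast_rpow 2 1 0 hε] with n hn hexp
  have ht : 2 * sqrtTwoLog n ≤ (n : ℝ) ^ ε := by
    rw [zero_add, zero_mul, zero_div, zero_add, one_mul] at hexp
    linarith [Real.add_one_le_exp (sqrtTwoLog n)]
  calc n * (((n : ℝ) ^ (-β)) ^ 2 * (2 * sqrtTwoLog n * ((n : ℝ) ^ (b - 1 / 2 + ε)) ^ 2))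
      ≤ n * (((n : ℝ) ^ (-β)) ^ 2 * ((n : ℝ) ^ ε * ((n : ℝ) ^ (b - 1 / 2 + ε)) ^ 2)) := by
        gcongr
    _ = (n : ℝ) ^ (1 : ℝ) * (((n : ℝ) ^ (-β)) ^ 2 *
          ((n : ℝ) ^ ε * ((n : ℝ) ^ (b - 1 / 2 + ε)) ^ 2)) := by
        rw [Real.rpow_one]
    _ = (n : ℝ) ^ (2 * (b - β) + 3 * ε) := by
        simp_rw [natCast_rpow_eq_exp hn, ← Real.exp_nat_mul, ← Real.exp_add]
        congr 1
        push_cast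
        ring

theorem tendsto_tvDist_zero (hβ0 : 0 ≤ β) (hβ : b < β)
    (hup : ∀ ε : ℝ, 0 < ε → ∀ᶠ n : ℕ in atTop, ∀ y ∈ Set.Icc 0 (sqrtTwoLog n),
      smoothedTail (G n) y ≤ (n : ℝ) ^ (b - 1 / 2 + ε) * Real.exp (-y ^ 2 / 4)) :
    Tendsto (fun n : ℕ => tvDist (nullLaw n) (altLaw G β n)) atTop (𝓝 0) := by
  set ε : ℝ := (β - b) / 2
  have hε : 0 < ε := half_pos (sub_pos.2 hβ)
  have hpow : Tendsto (fun n : ℕ => (n : ℝ) ^ (-ε)) atTop (𝓝 0) :=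
    (tendsto_rpow_neg_atTop hε).comp tendsto_natCast_atTop_atTop
  have hδ : Tendsto (fun n : ℕ => 2 / sqrtTwoLog n + 2 * (n : ℝ) ^ (-ε)) atTop (𝓝 0) := by
    simpa only [mul_zero, add_zero] using
      (tendsto_sqrtTwoLog.const_div_atTop 2).add (hpow.const_mul 2)
  have hlim : Tendsto (fun n : ℕ => (2 / sqrtTwoLog n + 2 * (n : ℝ) ^ (-ε)) +
      √(Real.exp ((n : ℝ) ^ (-ε)) - 2 * (1 - (2 / sqrtTwoLog n + 2 * (n : ℝ) ^ (-ε))) + 1))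
      atTop (𝓝 0) := by
    have hsqrt := ((((Real.continuous_exp.tendsto 0).comp hpow).sub
      ((hδ.const_sub 1).const_mul 2)).add_const 1).sqrt
    have hzero : 0 + √(Real.exp 0 - 2 * (1 - 0) + 1) = 0 := by
      norm_num
    exact hzero ▸ hδ.add hsqrt
  refine tendsto_of_tendsto_of_tendsto_of_le_of_le' tendsto_const_nhds hlim
    (Eventually.of_forall fun n => tvDist_nonneg) ?_
  filter_upwards [eventually_ge_atTop 1, tendsto_sqrtTwoLog.eventually_gt_atTop 0, hup ε hε,
    eventually_natCast_mul_sq_le hε] with n hn ht hJ hη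
  have hp0 : 0 ≤ (n : ℝ) ^ (-β) := by positivity
  have hp1 : (n : ℝ) ^ (-β) ≤ 1 := natCast_rpow_neg_le_one hn hβ0
  refine tvDist_pi_mixtureLaw_le hp0 hp1 ht.le hJ ?_ (hη.trans_eq ?_)
  · have hexc := natCast_mul_rpow_mul_exceedanceProb_le (β := β) hn (hJ _ ⟨ht.le, le_rfl⟩)
    rw [show b - β + ε = -ε by ring] at hexc
    have hmix := mul_le_mul_of_nonneg_left (mixtureLaw_lt_abs_le (G n) hp0 hp1 (sqrtTwoLog n))
      n.cast_nonneg
    linarith [natCast_mul_gaussianReal_lt_abs_le hn ht]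
  · congr 1
    ring

end Merging

section Criterion

variable {G : ℕ → Measure ℝ} {b : ℝ}

theorem isCriticalSparsity_of_tendsto (hb0 : 0 ≤ b) (hb1 : b ≤ 1)
    (hsep : ∀ β : ℝ, 0 ≤ β → β < b →
      Tendsto (fun n : ℕ => tvDist (nullLaw n) (altLaw G β n)) atTop (𝓝 1))
    (hmerge : ∀ β : ℝ, b < β → β ≤ 1 →
      Tendsto (fun n : ℕ => tvDist (nullLaw n) (altLaw G β n)) atTop (𝓝 0)) :
    IsCriticalSparsity G b := by
  have hexcl {β : ℝ} (h1 : Tendsto (fun n : ℕ => tvDist (nullLaw n) (altLaw G β n)) atTop (𝓝 1)) :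
      ¬ Tendsto (fun n : ℕ => tvDist (nullLaw n) (altLaw G β n)) atTop (𝓝 0) :=
    fun h0 => one_ne_zero (tendsto_nhds_unique h1 h0)
  let b' : unitInterval := ⟨b, hb0, hb1⟩
  have hlower : lowerCriticalSparsity G = b' := by
    refine le_antisymm (sSup_le fun β hβ => ?_) (le_of_forall_lt fun β hβ => ?_)
    · by_contra hlt
      exact hexcl hβ (hmerge _ (show b < β from not_le.1 hlt) β.2.2)
    · obtain ⟨c, hc1, hc2⟩ := exists_between hβ
      exact hc1.trans_le (le_sSup (hsep c c.2.1 hc2))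
  have hupper : upperCriticalSparsity G = b' := by
    refine le_antisymm (le_of_forall_gt fun β hβ => ?_) (le_sInf fun β hβ => ?_)
    · obtain ⟨c, hc1, hc2⟩ := exists_between hβ
      exact (sInf_le (hmerge c hc1 c.2.2)).trans_lt hc2
    · by_contra hlt
      exact hexcl (hsep _ β.2.1 (show (β : ℝ) < b from not_le.1 hlt)) hβ
  exact ⟨congrArg Subtype.val hlower, congrArg Subtype.val hupper⟩

theorem maxTestAttainsCriticalSparsity_of_bounds [∀ n, IsProbabilityMeasure (G n)]
    (hb0 : 0 ≤ b) (hb1 : b ≤ 1)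
    (hlow : ∀ ε : ℝ, 0 < ε → ∀ᶠ n : ℕ in atTop,
      (n : ℝ) ^ (b - 1 - ε) ≤ exceedanceProb (G n) (sqrtTwoLog n))
    (hup : b < 1 → ∀ ε : ℝ, 0 < ε → ∀ᶠ n : ℕ in atTop, ∀ y ∈ Set.Icc 0 (sqrtTwoLog n),
      smoothedTail (G n) y ≤ (n : ℝ) ^ (b - 1 / 2 + ε) * Real.exp (-y ^ 2 / 4)) :
    MaxTestAttainsCriticalSparsity G b := by
  have haccept (β : ℝ) (h0 : 0 ≤ β) (h : β < b) :
      Tendsto (fun n : ℕ => (altLaw G β n).real {x | ∀ i, |x i| ≤ sqrtTwoLog n}) atTop (𝓝 0) :=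
    tendsto_altLaw_forall_abs_le h0 h hlow
  refine ⟨isCriticalSparsity_of_tendsto hb0 hb1 (fun β h0 h => ?_) fun β h h1 => ?_,
    fun β h0 h => hasFullAsymptoticPower_maxTest h0 (haccept β h0 h)⟩
  · exact tendsto_tvDist_one h0 (haccept β h0 h)
  · exact tendsto_tvDist_zero (hb0.trans h.le) h (hup (h.trans_le h1))

end Criterion

section Density

theorem exists_le_mul_abs {g k : ℝ → ℝ} (hk : ∀ θ, 0 < θ → 0 ≤ k θ) (hright : g =O[atTop] k)
    (hleft : (fun θ => g (-θ)) =O[atTop] k) :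
    ∃ A C : ℝ, 0 < A ∧ 0 ≤ C ∧ ∀ θ, A < |θ| → g θ ≤ C * k |θ| := by
  obtain ⟨C₁, hC₁, h₁⟩ := hright.exists_nonneg
  obtain ⟨C₂, -, h₂⟩ := hleft.exists_nonneg
  obtain ⟨A, hA⟩ := eventually_atTop.1
    ((h₁.bound.and h₂.bound).and (eventually_gt_atTop (0 : ℝ)))
  refine ⟨max A 1, max C₁ C₂, by positivity, le_max_of_le_left hC₁, fun θ hθ => ?_⟩
  have hone_side {C x : ℝ} (hC : C ≤ max C₁ C₂) (hx : |g x| ≤ C * |k (|θ|)|) :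
      g x ≤ max C₁ C₂ * k |θ| := by
    have hkθ : 0 ≤ k |θ| := hk _ (one_pos.trans ((le_max_right A 1).trans_lt hθ))
    rw [abs_of_nonneg hkθ] at hx
    exact (le_abs_self _).trans (hx.trans (mul_le_mul_of_nonneg_right hC hkθ))
  obtain ⟨⟨hpos, hneg⟩, -⟩ := hA |θ| ((le_max_left A 1).trans hθ.le)
  rcases abs_choice θ with habs | habs
  · refine hone_side (le_max_left _ _) ?_
    simpa only [habs, Real.norm_eq_abs] using hpos
  · refine hone_side (le_max_right _ _) ?_
    simpa only [habs, neg_neg, Real.norm_eq_abs] using hneg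

theorem exists_mul_le {g k : ℝ → ℝ} (hg : ∀ θ, 0 ≤ g θ) (h : k =O[atTop] g) :
    ∃ A c : ℝ, 0 < A ∧ 0 < c ∧ ∀ θ, A ≤ θ → c * k θ ≤ g θ := by
  obtain ⟨C, hC, hbound⟩ := h.exists_pos
  obtain ⟨A, hA⟩ := eventually_atTop.1 hbound.bound
  refine ⟨max A 1, C⁻¹, by positivity, inv_pos.2 hC, fun θ hθ => ?_⟩
  have hθ := hA θ ((le_max_left A 1).trans hθ)
  rw [Real.norm_of_nonneg (hg θ)] at hθ
  rw [inv_mul_le_iff₀ hC]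
  exact (Real.le_norm_self _).trans hθ

theorem indicator_Ioi_abs (f : ℝ → ℝ) {a : ℝ} (ha : 0 ≤ a) (x : ℝ) :
    (Set.Ioi a).indicator f |x| = (Set.Ioi a).indicator f x + (Set.Ioi a).indicator f (-x) := by
  have hzero {y : ℝ} (hy : y ≤ 0) : (Set.Ioi a).indicator f y = 0 :=
    Set.indicator_of_notMem (Set.notMem_Ioi.2 (hy.trans ha)) f
  rcases le_total 0 x with hx | hx
  · rw [abs_of_nonneg hx, hzero (neg_nonpos.2 hx), add_zero]
  · rw [abs_of_nonpos hx, hzero hx, zero_add]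

theorem integrable_indicator_Ioi_abs {f : ℝ → ℝ} {a : ℝ} (ha : 0 ≤ a)
    (hf : IntegrableOn f (Set.Ioi a)) : Integrable fun x => (Set.Ioi a).indicator f |x| := by
  have hind : Integrable ((Set.Ioi a).indicator f) :=
    (integrable_indicator_iff measurableSet_Ioi).2 hf
  simp only [indicator_Ioi_abs f ha]
  exact hind.add hind.comp_neg

theorem integral_indicator_Ioi_abs (f : ℝ → ℝ) {a : ℝ} (ha : 0 ≤ a) :
    ∫ x, (Set.Ioi a).indicator f |x| = 2 * ∫ x in Set.Ioi a, f x := by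
  rw [integral_comp_abs, setIntegral_indicator measurableSet_Ioi,
    Set.inter_eq_right.2 (Set.Ioi_subset_Ioi ha)]

variable {G : Measure ℝ} {g : ℝ → ℝ}

theorem integrable_iff_integrable_density_mul (hg_meas : Measurable g) (hg_nonneg : ∀ θ, 0 ≤ g θ)
    (hG : G = volume.withDensity fun θ => ENNReal.ofReal (g θ)) {φ : ℝ → ℝ} :
    Integrable φ G ↔ Integrable fun θ => g θ * φ θ := by
  rw [hG, integrable_withDensity_iff_integrable_smul' hg_meas.ennreal_ofReal
    (ae_of_all _ fun _ => ENNReal.ofReal_lt_top)]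
  simp only [ENNReal.toReal_ofReal (hg_nonneg _), smul_eq_mul]

theorem integral_eq_integral_density_mul (hg_meas : Measurable g) (hg_nonneg : ∀ θ, 0 ≤ g θ)
    (hG : G = volume.withDensity fun θ => ENNReal.ofReal (g θ)) (φ : ℝ → ℝ) :
    ∫ θ, φ θ ∂G = ∫ θ, g θ * φ θ := by
  rw [hG, integral_withDensity_eq_integral_toReal_smul hg_meas.ennreal_ofReal
    (ae_of_all _ fun _ => ENNReal.ofReal_lt_top)]
  simp only [ENNReal.toReal_ofReal (hg_nonneg _), smul_eq_mul]

variable [IsProbabilityMeasure G]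

theorem integrable_density (hg_meas : Measurable g) (hg_nonneg : ∀ θ, 0 ≤ g θ)
    (hG : G = volume.withDensity fun θ => ENNReal.ofReal (g θ)) : Integrable g := by
  have := (integrable_iff_integrable_density_mul hg_meas hg_nonneg hG (φ := fun _ => 1)).1
    (integrable_const 1)
  simpa only [mul_one] using this

theorem integral_density (hg_meas : Measurable g) (hg_nonneg : ∀ θ, 0 ≤ g θ)
    (hG : G = volume.withDensity fun θ => ENNReal.ofReal (g θ)) : ∫ θ, g θ = 1 := by
  have := integral_eq_integral_density_mul hg_meas hg_nonneg hG fun _ => 1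
  simpa only [mul_one, integral_const, probReal_univ, smul_eq_mul] using this.symm

theorem integral_comp_abs_le (hg_meas : Measurable g) (hg_nonneg : ∀ θ, 0 ≤ g θ)
    (hG : G = volume.withDensity fun θ => ENNReal.ofReal (g θ)) {A C : ℝ}
    {k f : ℝ → ℝ} (hA : 0 ≤ A) (hbound : ∀ θ, A < |θ| → g θ ≤ C * k |θ|) (hf : Monotone f)
    (hf0 : ∀ u, 0 ≤ f u) (hkf : IntegrableOn (fun θ => k θ * f θ) (Set.Ioi A)) :
    Integrable (fun θ => f |θ|) G ∧
      ∫ θ, f |θ| ∂G ≤ f A + 2 * C * ∫ θ in Set.Ioi A, k θ * f θ := by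
  have hg := integrable_density hg_meas hg_nonneg hG
  have hw := integrable_indicator_Ioi_abs hA hkf
  set w := (Set.Ioi A).indicator fun θ => k θ * f θ
  have hdom : Integrable fun θ => f A * g θ + C * w |θ| := (hg.const_mul _).add (hw.const_mul _)
  have hle (θ : ℝ) : g θ * f |θ| ≤ f A * g θ + C * w |θ| := by
    rcases le_or_gt |θ| A with hθ | hθ
    · have hw_zero : w |θ| = 0 := Set.indicator_of_notMem (Set.notMem_Ioi.2 hθ) _
      rw [hw_zero, mul_zero, add_zero, mul_comm]
      exact mul_le_mul_of_nonneg_right (hf hθ) (hg_nonneg θ)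
    · have hw_eq : w |θ| = k |θ| * f |θ| := Set.indicator_of_mem (Set.mem_Ioi.2 hθ) _
      rw [hw_eq, ← mul_assoc]
      exact (mul_le_mul_of_nonneg_right (hbound θ hθ) (hf0 _)).trans
        (le_add_of_nonneg_left (mul_nonneg (hf0 A) (hg_nonneg θ)))
  have hint : Integrable fun θ => g θ * f |θ| := by
    refine hdom.mono' (hg_meas.mul (hf.measurable.comp measurable_abs)).aestronglyMeasurable
      (ae_of_all _ fun θ => ?_)
    rw [Real.norm_of_nonneg (mul_nonneg (hg_nonneg θ) (hf0 _))]
    exact hle θ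
  refine ⟨(integrable_iff_integrable_density_mul hg_meas hg_nonneg hG).2 hint, ?_⟩
  rw [integral_eq_integral_density_mul hg_meas hg_nonneg hG]
  calc ∫ θ, g θ * f |θ| ≤ ∫ θ, f A * g θ + C * w |θ| := integral_mono hint hdom hle
    _ = f A + 2 * C * ∫ θ in Set.Ioi A, k θ * f θ := by
        rw [integral_add (hg.const_mul _) (hw.const_mul _), integral_const_mul,
          integral_const_mul, integral_density hg_meas hg_nonneg hG,
          integral_indicator_Ioi_abs _ hA]
        ring

theorem mul_le_real_Ioi (hg_meas : Measurable g) (hg_nonneg : ∀ θ, 0 ≤ g θ)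
    (hG : G = volume.withDensity fun θ => ENNReal.ofReal (g θ))
    {a m w : ℝ} (hw : 0 ≤ w) (hm : ∀ θ ∈ Set.Ioc a (a + w), m ≤ g θ) :
    m * w ≤ G.real (Set.Ioi a) := by
  have hg := integrable_density hg_meas hg_nonneg hG
  calc m * w = ∫ _ in Set.Ioc a (a + w), m := by
        rw [setIntegral_const, Real.volume_real_Ioc_of_le (by linarith), smul_eq_mul]
        ring
    _ ≤ ∫ θ in Set.Ioc a (a + w), g θ :=
        setIntegral_mono_on (integrableOn_const (by simp)) hg.integrableOn measurableSet_Ioc hm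
    _ = G.real (Set.Ioc a (a + w)) := by
        rw [hG, withDensity_ofReal_real_apply hg_nonneg hg measurableSet_Ioc]
    _ ≤ G.real (Set.Ioi a) := measureReal_mono fun θ hθ => hθ.1

end Density

section ScaleFamily

instance isProbabilityMeasure_scaleFamily (G : Measure ℝ) [IsProbabilityMeasure G] (σ : ℕ → ℝ)
    (n : ℕ) : IsProbabilityMeasure (scaleFamily G σ n) :=
  Measure.isProbabilityMeasure_map (measurable_const_mul (σ n)).aemeasurable

variable {G : Measure ℝ} {σ : ℕ → ℝ} {n : ℕ}

theorem scaleFamily_real_Ioi_mul (hσ : 0 < σ n) (a : ℝ) :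
    (scaleFamily G σ n).real (Set.Ioi (σ n * a)) = G.real (Set.Ioi a) := by
  rw [scaleFamily, map_measureReal_apply (measurable_const_mul (σ n)) measurableSet_Ioi]
  congr 1
  ext θ
  exact mul_lt_mul_iff_right₀ hσ

theorem scaleFamily_real_setOf_lt_abs (hσ : 0 < σ n) (a : ℝ) :
    (scaleFamily G σ n).real {m | a < |m|} = G.real {θ | a / σ n < |θ|} := by
  rw [scaleFamily,
    map_measureReal_apply (measurable_const_mul (σ n)) (measurableSet_setOf_lt_abs a)]
  congr 1
  ext θ
  change a < |σ n * θ| ↔ a / σ n < |θ|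
  rw [abs_mul, abs_of_pos hσ, div_lt_iff₀' hσ]

theorem smoothedTail_scaleFamily_le_mgf [IsProbabilityMeasure G] (hσ : 0 ≤ σ n) {l : ℝ}
    (hl : 0 ≤ l) (hint : Integrable (fun θ => Real.exp (σ n * l * |θ|)) G) (y : ℝ) :
    smoothedTail (scaleFamily G σ n) y ≤
      Real.exp (-l * y + l ^ 2 / 2) * mgf (fun θ => |θ|) G (σ n * l) := by
  have hmeas : Measurable fun θ => σ n * θ := measurable_const_mul (σ n)
  have hexp : Measurable fun m : ℝ => Real.exp (l * |m|) := by fun_prop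
  have hcomp (θ : ℝ) : Real.exp (l * |σ n * θ|) = Real.exp (σ n * l * |θ|) := by
    rw [abs_mul, abs_of_nonneg hσ, ← mul_assoc, mul_comm l]
  have hmgf : mgf (fun m => |m|) (scaleFamily G σ n) l = mgf (fun θ => |θ|) G (σ n * l) := by
    simp only [mgf, scaleFamily, integral_map hmeas.aemeasurable hexp.aestronglyMeasurable, hcomp]
  rw [← hmgf]
  refine smoothedTail_le_mgf _ hl ?_ y
  rw [scaleFamily, integrable_map_measure hexp.aestronglyMeasurable hmeas.aemeasurable]
  simpa only [Function.comp_def, hcomp] using hint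

theorem mul_le_exceedanceProb_scaleFamily [IsProbabilityMeasure G] {g : ℝ → ℝ}
    (hg_meas : Measurable g) (hg_nonneg : ∀ θ, 0 ≤ g θ)
    (hG : G = volume.withDensity fun θ => ENNReal.ofReal (g θ)) (hσ : 0 < σ n) {a s t w m : ℝ}
    (hs : 0 ≤ s) (hw : 0 ≤ w) (ht : t ≤ σ n * a + s) (hm : ∀ θ ∈ Set.Ioc a (a + w), m ≤ g θ) :
    m * w * ((√(2 * Real.pi))⁻¹ * Real.exp (-(s + 1) ^ 2 / 2)) ≤
      exceedanceProb (scaleFamily G σ n) t :=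
  calc m * w * ((√(2 * Real.pi))⁻¹ * Real.exp (-(s + 1) ^ 2 / 2))
      ≤ G.real (Set.Ioi a) * (gaussianReal 0 1).real (Set.Ioi s) :=
        mul_le_mul (mul_le_real_Ioi hg_meas hg_nonneg hG hw hm) (le_gaussianReal_Ioi hs)
          (by positivity) measureReal_nonneg
    _ = (scaleFamily G σ n).real (Set.Ioi (σ n * a)) * (gaussianReal 0 1).real (Set.Ioi s) := by
        rw [scaleFamily_real_Ioi_mul hσ]
    _ ≤ exceedanceProb (scaleFamily G σ n) t := mul_le_exceedanceProb _ ht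

end ScaleFamily

theorem maxTestAttainsCriticalSparsity_of_exp_bounds {G : ℕ → Measure ℝ}
    [∀ n, IsProbabilityMeasure (G n)] {b : ℝ} (hb0 : 0 ≤ b) (hb1 : b ≤ 1)
    (hlow : ∃ c K : ℝ, 0 < c ∧ ∀ᶠ n : ℕ in atTop,
      c * Real.exp ((b - 1) * sqrtTwoLog n ^ 2 / 2 - K * sqrtTwoLog n) ≤
        exceedanceProb (G n) (sqrtTwoLog n))
    (hup : b < 1 → ∃ C K : ℝ, ∀ᶠ n : ℕ in atTop, ∀ y ∈ Set.Icc 0 (sqrtTwoLog n),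
      smoothedTail (G n) y ≤
        C * Real.exp (-y ^ 2 / 4 + (b - 1 / 2) * sqrtTwoLog n ^ 2 / 2 + K * sqrtTwoLog n)) :
    MaxTestAttainsCriticalSparsity G b := by
  refine maxTestAttainsCriticalSparsity_of_bounds hb0 hb1 (fun ε hε => ?_) fun hb ε hε => ?_
  · obtain ⟨c, K, hc, hlow⟩ := hlow
    filter_upwards [hlow, eventually_natCast_rpow_le_mul_exp hc K (b - 1) hε] with n hn hrate
    exact hrate.trans hn
  · obtain ⟨C, K, hup⟩ := hup hb
    filter_upwards [hup, eventually_mul_exp_le_natCast_rpow C K (b - 1 / 2) hε] with n hn hrate y hy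
    refine (hn y hy).trans ?_
    rw [add_assoc, Real.exp_add, mul_left_comm, mul_comm]
    exact mul_le_mul_of_nonneg_right hrate (Real.exp_pos _).le

section GaussianTail

variable {G : Measure ℝ} [IsProbabilityMeasure G] {g : ℝ → ℝ} {r γ : ℝ}

theorem isBigO_exp_neg_sub_sq {γ γ' : ℝ} (h : γ ≤ γ') :
    (fun θ : ℝ => Real.exp (-(θ - γ) ^ 2 / 2)) =O[atTop]
      fun θ : ℝ => Real.exp (-(θ - γ') ^ 2 / 2) := by
  refine IsBigO.of_bound 1 ?_
  filter_upwards [eventually_ge_atTop γ'] with θ hθ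
  rw [Real.norm_of_nonneg (Real.exp_pos _).le, Real.norm_of_nonneg (Real.exp_pos _).le, one_mul,
    Real.exp_le_exp]
  gcongr

theorem setIntegral_exp_neg_sub_sq_mul_exp_le (γ s A : ℝ) :
    IntegrableOn (fun θ : ℝ => Real.exp (-(θ - γ) ^ 2 / 2) * Real.exp (s * θ)) (Set.Ioi A) ∧
      ∫ θ in Set.Ioi A, Real.exp (-(θ - γ) ^ 2 / 2) * Real.exp (s * θ) ≤
        Real.exp (s * γ + s ^ 2 / 2) * √(2 * Real.pi) := by
  have hsquare (θ : ℝ) : Real.exp (-(θ - γ) ^ 2 / 2) * Real.exp (s * θ) =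
      Real.exp (s * γ + s ^ 2 / 2) * Real.exp (-(1 / 2) * (θ - (γ + s)) ^ 2) := by
    rw [← Real.exp_add, ← Real.exp_add]
    ring_nf
  have hint : Integrable fun θ : ℝ => Real.exp (-(1 / 2) * (θ - (γ + s)) ^ 2) :=
    (integrable_exp_neg_mul_sq one_half_pos).comp_sub_right (γ + s)
  have hval : ∫ θ : ℝ, Real.exp (-(1 / 2) * (θ - (γ + s)) ^ 2) = √(2 * Real.pi) := by
    rw [integral_sub_right_eq_self (fun θ : ℝ => Real.exp (-(1 / 2) * θ ^ 2)), integral_gaussian,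
      div_div_eq_mul_div, div_one, mul_comm]
  simp only [hsquare]
  refine ⟨(hint.const_mul _).integrableOn, ?_⟩
  rw [integral_const_mul, ← hval]
  gcongr
  · exact ae_of_all _ fun θ => (Real.exp_pos _).le
  · exact Measure.restrict_le_self

theorem exists_mgf_abs_le_of_gaussian_tail (hg_meas : Measurable g) (hg_nonneg : ∀ θ, 0 ≤ g θ)
    (hG : G = volume.withDensity fun θ => ENNReal.ofReal (g θ))
    (hright : g =O[atTop] fun θ : ℝ => Real.exp (-(θ - γ) ^ 2 / 2))
    (hleft : (fun θ => g (-θ)) =O[atTop] fun θ : ℝ => Real.exp (-(θ - γ) ^ 2 / 2)) :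
    ∃ C K : ℝ, 0 ≤ C ∧ 0 ≤ K ∧ ∀ s, 0 ≤ s → Integrable (fun θ => Real.exp (s * |θ|)) G ∧
      mgf (fun θ => |θ|) G s ≤ C * Real.exp (K * s + s ^ 2 / 2) := by
  obtain ⟨A, C, hA, hC, hbound⟩ := exists_le_mul_abs (fun θ _ => (Real.exp_pos _).le) hright hleft
  refine ⟨1 + 2 * C * √(2 * Real.pi), max A γ, by positivity, le_max_of_le_left hA.le,
    fun s hs => ?_⟩
  obtain ⟨hkint, hkle⟩ := setIntegral_exp_neg_sub_sq_mul_exp_le γ s A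
  obtain ⟨hint, hle⟩ := integral_comp_abs_le hg_meas hg_nonneg hG hA.le hbound
    (f := fun θ => Real.exp (s * θ))
    (fun _ _ h => Real.exp_le_exp.2 (mul_le_mul_of_nonneg_left h hs))
    (fun _ => (Real.exp_pos _).le) hkint
  refine ⟨hint, hle.trans ?_⟩
  have hAE : Real.exp (s * A) ≤ Real.exp (max A γ * s + s ^ 2 / 2) := by
    rw [Real.exp_le_exp, mul_comm]
    exact le_add_of_le_of_nonneg (by gcongr; exact le_max_left _ _) (by positivity)
  have hγE : Real.exp (s * γ + s ^ 2 / 2) ≤ Real.exp (max A γ * s + s ^ 2 / 2) := by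
    rw [mul_comm s]
    gcongr
    exact le_max_right _ _
  calc Real.exp (s * A) +
        2 * C * ∫ θ in Set.Ioi A, Real.exp (-(θ - γ) ^ 2 / 2) * Real.exp (s * θ)
      ≤ Real.exp (max A γ * s + s ^ 2 / 2) +
          2 * C * (Real.exp (max A γ * s + s ^ 2 / 2) * √(2 * Real.pi)) := by
        gcongr
        exact hkle.trans (by gcongr)
    _ = _ := by ring

theorem exists_le_exceedanceProb_of_gaussian_tail (hg_meas : Measurable g)
    (hg_nonneg : ∀ θ, 0 ≤ g θ) (hG : G = volume.withDensity fun θ => ENNReal.ofReal (g θ))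
    (hr : 0 < r) (h : (fun θ : ℝ => Real.exp (-(θ - γ) ^ 2 / 2)) =O[atTop] g) :
    ∃ c K : ℝ, 0 < c ∧ ∀ᶠ n : ℕ in atTop,
      c * Real.exp ((r ^ 2 / (r ^ 2 + 1) - 1) * sqrtTwoLog n ^ 2 / 2 - K * sqrtTwoLog n) ≤
        exceedanceProb (scaleFamily G (fun _ => r) n) (sqrtTwoLog n) := by
  obtain ⟨A, c, -, hc, hlow⟩ := exists_mul_le hg_nonneg h
  set q := r ^ 2 + 1 with hq
  have hq0 : 0 < q := by positivity
  refine ⟨c * (√(2 * Real.pi))⁻¹ * Real.exp (-((1 - γ) ^ 2 + 1) / 2),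
    r / q * (1 - γ) + 1 / q, by positivity, ?_⟩
  filter_upwards [(tendsto_sqrtTwoLog.const_mul_atTop (div_pos hr hq0)).eventually_ge_atTop
    (max A γ)] with n hn
  set t := sqrtTwoLog n
  have ht : 0 ≤ t := sqrtTwoLog_nonneg n
  have hdensity (θ : ℝ) (hθ : θ ∈ Set.Ioc (r / q * t) (r / q * t + 1)) :
      c * Real.exp (-(r / q * t + 1 - γ) ^ 2 / 2) ≤ g θ := by
    refine le_trans ?_ (hlow θ ((le_max_left A γ).trans (hn.trans hθ.1.le)))
    have hγ : 0 ≤ θ - γ := sub_nonneg.2 ((le_max_right A γ).trans (hn.trans hθ.1.le))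
    gcongr
    exact hθ.2
  have hreach : t ≤ r * (r / q * t) + t / q := by
    apply le_of_eq
    field_simp
    rw [hq]
  refine le_of_eq_of_le ?_ (mul_le_exceedanceProb_scaleFamily hg_meas hg_nonneg hG hr
    (div_nonneg ht hq0.le) zero_le_one hreach hdensity)
  have hexponent : -((1 - γ) ^ 2 + 1) / 2 +
        ((r ^ 2 / q - 1) * t ^ 2 / 2 - (r / q * (1 - γ) + 1 / q) * t) =
      -(r / q * t + 1 - γ) ^ 2 / 2 + -(t / q + 1) ^ 2 / 2 := by
    field_simp
    rw [hq]
    ring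
  rw [mul_assoc, ← Real.exp_add, hexponent, Real.exp_add]
  ring

theorem neg_sq_div_le {t y : ℝ} (hr : 1 ≤ r) (hy : y ∈ Set.Icc 0 t) :
    -y ^ 2 / (2 * (r ^ 2 + 1)) ≤ -y ^ 2 / 4 + (r ^ 2 / (r ^ 2 + 1) - 1 / 2) * t ^ 2 / 2 := by
  have hcoeff : 0 ≤ r ^ 2 / (r ^ 2 + 1) - 1 / 2 := by
    rw [sub_nonneg, div_le_div_iff₀ two_pos (by positivity)]
    nlinarith
  calc -y ^ 2 / (2 * (r ^ 2 + 1))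
      = -y ^ 2 / 4 + (r ^ 2 / (r ^ 2 + 1) - 1 / 2) * y ^ 2 / 2 := by
        field_simp
        ring
    _ ≤ -y ^ 2 / 4 + (r ^ 2 / (r ^ 2 + 1) - 1 / 2) * t ^ 2 / 2 := by
        have := hy.1
        gcongr
        exact hy.2

theorem exists_smoothedTail_le_of_gaussian_tail (hg_meas : Measurable g)
    (hg_nonneg : ∀ θ, 0 ≤ g θ) (hG : G = volume.withDensity fun θ => ENNReal.ofReal (g θ))
    (hr : 1 ≤ r) (hright : g =O[atTop] fun θ : ℝ => Real.exp (-(θ - γ) ^ 2 / 2))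
    (hleft : (fun θ => g (-θ)) =O[atTop] fun θ : ℝ => Real.exp (-(θ - γ) ^ 2 / 2)) :
    ∃ C K : ℝ, ∀ n : ℕ, ∀ y ∈ Set.Icc 0 (sqrtTwoLog n),
      smoothedTail (scaleFamily G (fun _ => r) n) y ≤
        C * Real.exp (-y ^ 2 / 4 + (r ^ 2 / (r ^ 2 + 1) - 1 / 2) * sqrtTwoLog n ^ 2 / 2 +
          K * sqrtTwoLog n) := by
  obtain ⟨C, K, hC, hK, hmgf⟩ :=
    exists_mgf_abs_le_of_gaussian_tail hg_meas hg_nonneg hG hright hleft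
  set q := r ^ 2 + 1 with hq
  have hq0 : 0 < q := by positivity
  refine ⟨C, K * (r / q), fun n y hy => ?_⟩
  set t := sqrtTwoLog n
  have hl : 0 ≤ y / q := div_nonneg hy.1 hq0.le
  have hs : 0 ≤ r * (y / q) := mul_nonneg (by linarith) hl
  have hexponent : -(y / q) * y + (y / q) ^ 2 / 2 + (r * (y / q)) ^ 2 / 2 = -y ^ 2 / (2 * q) := by
    field_simp
    rw [hq]
    ring
  have hlin : K * (r * (y / q)) ≤ K * (r / q) * t := by
    rw [← mul_div_assoc, mul_div_right_comm, ← mul_assoc]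
    exact mul_le_mul_of_nonneg_left hy.2 (by positivity)
  calc smoothedTail (scaleFamily G (fun _ => r) n) y
      ≤ Real.exp (-(y / q) * y + (y / q) ^ 2 / 2) * mgf (fun θ => |θ|) G (r * (y / q)) :=
        smoothedTail_scaleFamily_le_mgf (by linarith) hl (hmgf _ hs).1 y
    _ ≤ Real.exp (-(y / q) * y + (y / q) ^ 2 / 2) *
          (C * Real.exp (K * (r * (y / q)) + (r * (y / q)) ^ 2 / 2)) := by
        gcongr
        exact (hmgf _ hs).2
    _ = C * Real.exp (-y ^ 2 / (2 * q) + K * (r * (y / q))) := by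
        rw [mul_left_comm, ← Real.exp_add, ← hexponent]
        ring_nf
    _ ≤ C * Real.exp (-y ^ 2 / 4 + (r ^ 2 / q - 1 / 2) * t ^ 2 / 2 + K * (r / q) * t) := by
        gcongr
        exact neg_sq_div_le hr hy

theorem maxTestAttainsCriticalSparsity_gaussian {γ' : ℝ} (hg_meas : Measurable g)
    (hg_nonneg : ∀ θ, 0 ≤ g θ) (hG : G = volume.withDensity fun θ => ENNReal.ofReal (g θ))
    (hr : 1 ≤ r) (hright : g =Θ[atTop] fun θ : ℝ => Real.exp (-(θ - γ) ^ 2 / 2))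
    (hleft : (fun θ => g (-θ)) =O[atTop] fun θ : ℝ => Real.exp (-(θ - γ') ^ 2 / 2)) :
    MaxTestAttainsCriticalSparsity (scaleFamily G fun _ => r) (r ^ 2 / (r ^ 2 + 1)) := by
  obtain ⟨C, K, hup⟩ := exists_smoothedTail_le_of_gaussian_tail hg_meas hg_nonneg hG hr
    (hright.1.trans (isBigO_exp_neg_sub_sq (le_max_left γ γ')))
    (hleft.trans (isBigO_exp_neg_sub_sq (le_max_right γ γ')))
  exact maxTestAttainsCriticalSparsity_of_exp_bounds (by positivity)
    ((div_le_one (by positivity)).2 (by linarith))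
    (exists_le_exceedanceProb_of_gaussian_tail hg_meas hg_nonneg hG (one_pos.trans_le hr) hright.2)
    fun _ => ⟨C, K, Eventually.of_forall hup⟩

end GaussianTail

section ExponentialTail

variable {G : Measure ℝ} [IsProbabilityMeasure G] {g : ℝ → ℝ} {r : ℝ}

theorem exists_mgf_abs_le_of_exponential_tail (hg_meas : Measurable g) (hg_nonneg : ∀ θ, 0 ≤ g θ)
    (hG : G = volume.withDensity fun θ => ENNReal.ofReal (g θ))
    (hright : g =O[atTop] fun θ : ℝ => Real.exp (-θ))
    (hleft : (fun θ => g (-θ)) =O[atTop] fun θ : ℝ => Real.exp (-θ)) :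
    ∃ C : ℝ, 0 ≤ C ∧ ∀ s, 0 ≤ s → s < 1 → Integrable (fun θ => Real.exp (s * |θ|)) G ∧
      mgf (fun θ => |θ|) G s ≤ C / (1 - s) := by
  obtain ⟨A, C, hA, hC, hbound⟩ := exists_le_mul_abs (fun θ _ => (Real.exp_pos _).le) hright hleft
  refine ⟨Real.exp A + 2 * C, by positivity, fun s hs0 hs1 => ?_⟩
  have hgap : 0 < 1 - s := sub_pos.2 hs1
  have htilt (θ : ℝ) : Real.exp (-θ) * Real.exp (s * θ) = Real.exp ((s - 1) * θ) := by
    rw [← Real.exp_add]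
    ring_nf
  obtain ⟨hint, hle⟩ := integral_comp_abs_le hg_meas hg_nonneg hG hA.le
    (k := fun θ => Real.exp (-θ)) (f := fun θ => Real.exp (s * θ)) hbound
    (fun _ _ h => Real.exp_le_exp.2 (mul_le_mul_of_nonneg_left h hs0))
    (fun _ => (Real.exp_pos _).le)
    (by simpa only [htilt] using integrableOn_exp_mul_Ioi (sub_neg.2 hs1) A)
  refine ⟨hint, hle.trans ?_⟩
  have hexpA : Real.exp (s * A) ≤ Real.exp A / (1 - s) :=
    (Real.exp_le_exp.2 (mul_le_of_le_one_left hA.le hs1.le)).trans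
      (le_div_self (Real.exp_pos A).le hgap (sub_le_self 1 hs0))
  have htail : ∫ θ in Set.Ioi A, Real.exp (-θ) * Real.exp (s * θ) ≤ 1 / (1 - s) := by
    simp only [htilt]
    rw [integral_exp_mul_Ioi (sub_neg.2 hs1), ← neg_sub, neg_div_neg_eq]
    gcongr
    exact Real.exp_le_one_iff.2 (by nlinarith)
  calc Real.exp (s * A) + 2 * C * ∫ θ in Set.Ioi A, Real.exp (-θ) * Real.exp (s * θ)
      ≤ Real.exp A / (1 - s) + 2 * C * (1 / (1 - s)) := by gcongr
    _ = (Real.exp A + 2 * C) / (1 - s) := by ring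

theorem exists_le_exceedanceProb_of_exponential_tail (hg_meas : Measurable g)
    (hg_nonneg : ∀ θ, 0 ≤ g θ) (hG : G = volume.withDensity fun θ => ENNReal.ofReal (g θ))
    (hr : 1 < r) (h : (fun θ : ℝ => Real.exp (-θ)) =O[atTop] g) :
    ∃ c K : ℝ, 0 < c ∧ ∀ᶠ n : ℕ in atTop,
      c * Real.exp (((1 - 1 / r) ^ 2 - 1) * sqrtTwoLog n ^ 2 / 2 - K * sqrtTwoLog n) ≤
        exceedanceProb (scaleFamily G (fun n => r / sqrtTwoLog n) n) (sqrtTwoLog n) := by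
  obtain ⟨A, c, -, hc, hlow⟩ := exists_mul_le hg_nonneg h
  have hr0 : 0 < r := one_pos.trans hr
  have hcoeff : 0 < (1 - 1 / r) / r := div_pos (sub_pos.2 ((div_lt_one hr0).2 hr)) hr0
  refine ⟨c * (√(2 * Real.pi))⁻¹ * Real.exp (-3 / 2), 1 / r, by positivity, ?_⟩
  filter_upwards [tendsto_sqrtTwoLog.eventually_gt_atTop 0,
    (((tendsto_pow_atTop two_ne_zero).comp tendsto_sqrtTwoLog).const_mul_atTop
      hcoeff).eventually_ge_atTop A] with n ht hn
  simp only [Function.comp_apply] at hn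
  set t := sqrtTwoLog n
  set a := (1 - 1 / r) / r * t ^ 2
  have hdensity (θ : ℝ) (hθ : θ ∈ Set.Ioc a (a + 1)) : c * Real.exp (-(a + 1)) ≤ g θ := by
    refine le_trans ?_ (hlow θ (hn.trans hθ.1.le))
    gcongr
    exact hθ.2
  have hreach : t ≤ r / t * a + t / r := by
    apply le_of_eq
    simp only [a]
    field_simp
    ring
  refine le_of_eq_of_le ?_ (mul_le_exceedanceProb_scaleFamily hg_meas hg_nonneg hG
    (div_pos hr0 ht) (div_nonneg ht.le hr0.le) zero_le_one hreach hdensity)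
  have hexponent : -3 / 2 + (((1 - 1 / r) ^ 2 - 1) * t ^ 2 / 2 - 1 / r * t) =
      -(a + 1) + -(t / r + 1) ^ 2 / 2 := by
    simp only [a]
    field_simp
    ring
  rw [mul_assoc, ← Real.exp_add, hexponent, Real.exp_add]
  ring

theorem max_sub_sq_le {d t y : ℝ} (hd1 : d ≤ 1) (hd : 1 / 2 ≤ (1 - d) ^ 2) (hy0 : 0 ≤ y)
    (hyt : y ≤ t) :
    (max (y - d * t) 0) ^ 2 ≤ y ^ 2 / 2 + ((1 - d) ^ 2 - 1 / 2) * t ^ 2 := by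
  rcases le_total (y - d * t) 0 with hdt | hdt
  · rw [max_eq_right hdt, zero_pow two_ne_zero]
    exact add_nonneg (by positivity) (mul_nonneg (sub_nonneg.2 hd) (sq_nonneg t))
  · rw [max_eq_left hdt]
    have hd3 : d ≤ 1 / 3 := by nlinarith
    have hslope : 0 ≤ t + y - 4 * d * t := by
      nlinarith [mul_le_mul_of_nonneg_right hd3 (hy0.trans hyt)]
    linear_combination (t - y) * hslope / 2

theorem chernoff_exponent_le {d t y : ℝ} (hd : 0 ≤ d) (ht : 1 ≤ t) (hy0 : 0 ≤ y) (hyt : y ≤ t) :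
    -((1 - 1 / t ^ 2) * min y (d * t)) * y + ((1 - 1 / t ^ 2) * min y (d * t)) ^ 2 / 2 ≤
      1 - y ^ 2 / 2 + (max (y - d * t) 0) ^ 2 / 2 := by
  have ht0 : 0 < t := one_pos.trans_le ht
  set p := min y (d * t)
  have hp0 : 0 ≤ p := le_min hy0 (mul_nonneg hd ht0.le)
  have hmax : max (y - d * t) 0 = y - p := by
    rw [sub_eq_add_neg y p, ← max_neg_neg, ← max_add_add_left, add_neg_cancel, max_comm,
      ← sub_eq_add_neg]
  have hcross : 1 / t ^ 2 * (p * y) ≤ 1 := by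
    rw [one_div_mul_eq_div, div_le_one (by positivity), sq]
    exact mul_le_mul ((min_le_left _ _).trans hyt) hyt hy0 ht0.le
  have hsq : ((1 - 1 / t ^ 2) * p) ^ 2 ≤ p ^ 2 := by
    have hshrink : 1 / t ^ 2 ≤ 1 := (div_le_one (by positivity)).2 (one_le_pow₀ ht)
    exact pow_le_pow_left₀ (mul_nonneg (sub_nonneg.2 hshrink) hp0)
      (mul_le_of_le_one_left hp0 (sub_le_self 1 (by positivity))) 2
  rw [hmax]
  linear_combination hcross + hsq / 2

theorem inv_sq_le_one_sub_tilt {t p : ℝ} (hr : 0 < r) (ht : 1 ≤ t) (hp : p ≤ 1 / r * t) :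
    1 / t ^ 2 ≤ 1 - r / t * ((1 - 1 / t ^ 2) * p) := by
  have ht0 : 0 < t := one_pos.trans_le ht
  have hshrink : 0 ≤ 1 - 1 / t ^ 2 :=
    sub_nonneg.2 ((div_le_one (by positivity)).2 (one_le_pow₀ ht))
  have htilt : r / t * p ≤ 1 := by
    calc r / t * p ≤ r / t * (1 / r * t) :=
          mul_le_mul_of_nonneg_left hp (div_nonneg hr.le ht0.le)
      _ = 1 := by field_simp
  linear_combination (1 - 1 / t ^ 2) * htilt

theorem div_le_two_mul_mul_exp {C x t : ℝ} (hC : 0 ≤ C) (ht : 0 < t) (hx : 1 / t ^ 2 ≤ x) :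
    C / x ≤ 2 * C * Real.exp t := by
  have ht_sq : t ^ 2 ≤ 2 * Real.exp t := by linarith [Real.quadratic_le_exp_of_nonneg ht.le]
  calc C / x ≤ C / (1 / t ^ 2) := by gcongr
    _ = C * t ^ 2 := by rw [div_div_eq_mul_div, div_one]
    _ ≤ C * (2 * Real.exp t) := by gcongr
    _ = 2 * C * Real.exp t := by ring

theorem exists_smoothedTail_le_of_exponential_tail (hg_meas : Measurable g)
    (hg_nonneg : ∀ θ, 0 ≤ g θ) (hG : G = volume.withDensity fun θ => ENNReal.ofReal (g θ))
    (hr1 : 1 ≤ r) (hr : 1 / 2 ≤ (1 - 1 / r) ^ 2) (hright : g =O[atTop] fun θ : ℝ => Real.exp (-θ))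
    (hleft : (fun θ => g (-θ)) =O[atTop] fun θ : ℝ => Real.exp (-θ)) :
    ∃ C K : ℝ, ∀ᶠ n : ℕ in atTop, ∀ y ∈ Set.Icc 0 (sqrtTwoLog n),
      smoothedTail (scaleFamily G (fun n => r / sqrtTwoLog n) n) y ≤
        C * Real.exp (-y ^ 2 / 4 + ((1 - 1 / r) ^ 2 - 1 / 2) * sqrtTwoLog n ^ 2 / 2 +
          K * sqrtTwoLog n) := by
  obtain ⟨C, hC, hmgf⟩ := exists_mgf_abs_le_of_exponential_tail hg_meas hg_nonneg hG hright hleft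
  have hr0 : 0 < r := one_pos.trans_le hr1
  have hd0 : 0 ≤ 1 / r := (one_div_pos.2 hr0).le
  refine ⟨2 * C * Real.exp 1, 1, ?_⟩
  filter_upwards [tendsto_sqrtTwoLog.eventually_ge_atTop 1] with n ht y ⟨hy0, hyt⟩
  set t := sqrtTwoLog n
  have ht0 : 0 < t := one_pos.trans_le ht
  -- The unconstrained optimal tilt `min y (t / r)` may sit at the pole of the moment generating
  -- function; shrinking it by the factor `1 - 1 / t ^ 2` costs only a factor of order `t ^ 2`.
  set l := (1 - 1 / t ^ 2) * min y (1 / r * t)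
  have hl0 : 0 ≤ l := mul_nonneg
    (sub_nonneg.2 ((div_le_one (by positivity)).2 (one_le_pow₀ ht)))
    (le_min hy0 (mul_nonneg hd0 ht0.le))
  have hgap : 1 / t ^ 2 ≤ 1 - r / t * l := inv_sq_le_one_sub_tilt hr0 ht (min_le_right _ _)
  obtain ⟨hint, hle⟩ := hmgf (r / t * l) (by positivity)
    (sub_pos.1 ((one_div_pos.2 (by positivity)).trans_le hgap))
  have hexponent : -l * y + l ^ 2 / 2 ≤
      1 + (-y ^ 2 / 4 + ((1 - 1 / r) ^ 2 - 1 / 2) * t ^ 2 / 2) := by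
    linarith [chernoff_exponent_le hd0 ht hy0 hyt,
      max_sub_sq_le ((div_le_one hr0).2 hr1) hr hy0 hyt]
  calc smoothedTail (scaleFamily G (fun n => r / sqrtTwoLog n) n) y
      ≤ Real.exp (-l * y + l ^ 2 / 2) * mgf (fun θ => |θ|) G (r / t * l) :=
        smoothedTail_scaleFamily_le_mgf (div_nonneg hr0.le ht0.le) hl0 hint y
    _ ≤ Real.exp (1 + (-y ^ 2 / 4 + ((1 - 1 / r) ^ 2 - 1 / 2) * t ^ 2 / 2)) *
          (2 * C * Real.exp t) := by
        gcongr
        · exact mgf_nonneg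
        · exact hle.trans (div_le_two_mul_mul_exp hC ht0 hgap)
    _ = _ := by
        rw [Real.exp_add, Real.exp_add _ (1 * t), one_mul]
        ring

theorem one_lt_and_half_le_of_sqrt_two_div_le {r : ℝ} (hr : √2 / (√2 - 1) ≤ r) :
    1 < r ∧ 1 / 2 ≤ (1 - 1 / r) ^ 2 := by
  have hsqrt : 1 < √2 := Real.one_lt_sqrt_two
  have hgap : 0 < √2 - 1 := sub_pos.2 hsqrt
  have hr1 : 1 < r := ((one_lt_div hgap).2 (by linarith)).trans_le hr
  have hr0 : 0 < r := one_pos.trans hr1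
  have hone : 1 ≤ √2 * (1 - 1 / r) := by
    rw [div_le_iff₀ hgap] at hr
    rw [mul_one_sub, mul_one_div, le_sub_comm, div_le_iff₀' hr0]
    exact hr
  refine ⟨hr1, ?_⟩
  have hsq := one_le_pow₀ hone (n := 2)
  rw [mul_pow, Real.sq_sqrt two_pos.le] at hsq
  linarith

theorem maxTestAttainsCriticalSparsity_exponential (hg_meas : Measurable g)
    (hg_nonneg : ∀ θ, 0 ≤ g θ) (hG : G = volume.withDensity fun θ => ENNReal.ofReal (g θ))
    (hr : √2 / (√2 - 1) ≤ r) (hright : g =Θ[atTop] fun θ : ℝ => Real.exp (-θ))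
    (hleft : (fun θ => g (-θ)) =O[atTop] fun θ : ℝ => Real.exp (-θ)) :
    MaxTestAttainsCriticalSparsity (scaleFamily G fun n => r / sqrtTwoLog n)
      ((1 - 1 / r) ^ 2) := by
  obtain ⟨hr1, hhalf⟩ := one_lt_and_half_le_of_sqrt_two_div_le hr
  have hr0 : 0 < r := one_pos.trans hr1
  have hd1 : 1 / r ≤ 1 := (div_le_one hr0).2 hr1.le
  exact maxTestAttainsCriticalSparsity_of_exp_bounds (sq_nonneg _)
    (pow_le_one₀ (sub_nonneg.2 hd1) (sub_le_self 1 (by positivity)))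
    (exists_le_exceedanceProb_of_exponential_tail hg_meas hg_nonneg hG hr1 hright.2)
    fun _ => exists_smoothedTail_le_of_exponential_tail hg_meas hg_nonneg hG hr1.le hhalf
      hright.1 hleft

theorem mul_two_log_rpow_eq_div_sqrtTwoLog (r : ℝ) (n : ℕ) :
    r * (2 * Real.log n) ^ (-(1 / 2) : ℝ) = r / sqrtTwoLog n := by
  rw [Real.rpow_neg (mul_nonneg two_pos.le (Real.log_natCast_nonneg n)), ← Real.sqrt_eq_rpow,
    div_eq_mul_inv, sqrtTwoLog]

end ExponentialTail

section PolynomialTail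

variable {G : Measure ℝ} [IsProbabilityMeasure G] {g : ℝ → ℝ} {ν ρ : ℝ} {σ : ℕ → ℝ}

theorem eventually_mem_Icc_of_isEquivalent_rpow (hσ : σ ~[atTop] fun n : ℕ => (n : ℝ) ^ ρ) :
    ∀ᶠ n : ℕ in atTop, σ n ∈ Set.Icc (Real.exp (ρ * sqrtTwoLog n ^ 2 / 2) / 2)
      (2 * Real.exp (ρ * sqrtTwoLog n ^ 2 / 2)) := by
  filter_upwards [isLittleO_iff.1 hσ.isLittleO (one_half_pos (α := ℝ)),
    eventually_ge_atTop 1] with n hn hn1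
  rw [Pi.sub_apply, natCast_rpow_eq_exp hn1, Real.norm_of_nonneg (Real.exp_pos _).le,
    Real.norm_eq_abs, abs_le] at hn
  have := Real.exp_pos (ρ * sqrtTwoLog n ^ 2 / 2)
  constructor <;> linarith [hn.1, hn.2]

theorem exists_real_setOf_lt_abs_le_of_polynomial_tail (hg_meas : Measurable g)
    (hg_nonneg : ∀ θ, 0 ≤ g θ) (hG : G = volume.withDensity fun θ => ENNReal.ofReal (g θ))
    (hν : 0 < ν) (hright : g =O[atTop] fun θ : ℝ => θ ^ (-ν - 1))
    (hleft : (fun θ => g (-θ)) =O[atTop] fun θ : ℝ => θ ^ (-ν - 1)) :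
    ∃ C : ℝ, 0 ≤ C ∧ ∀ᶠ u in atTop, G.real {θ | u < |θ|} ≤ C * u ^ (-ν) := by
  obtain ⟨A, C, hA, hC, hbound⟩ :=
    exists_le_mul_abs (fun θ hθ => Real.rpow_nonneg (le_of_lt hθ) _) hright hleft
  refine ⟨2 * C / ν, by positivity, ?_⟩
  filter_upwards [eventually_ge_atTop A] with u hu
  have hu0 : 0 < u := hA.trans_le hu
  have hexponent : -ν - 1 < -1 := by linarith
  set f : ℝ → ℝ := (Set.Ioi u).indicator 1
  have hf_mono : Monotone f := by
    intro x y hxy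
    by_cases hx : x ∈ Set.Ioi u
    · exact ((Set.indicator_of_mem hx 1).trans
        (Set.indicator_of_mem (lt_of_lt_of_le hx hxy) 1).symm).le
    · refine (Set.indicator_of_notMem hx _).trans_le ?_
      exact Set.indicator_nonneg (fun _ _ => zero_le_one) y
  have hkf : Set.EqOn (fun θ => θ ^ (-ν - 1) * f θ) (fun θ => θ ^ (-ν - 1)) (Set.Ioi u) :=
    fun θ hθ => by simp only [f, Set.indicator_of_mem hθ, Pi.one_apply, mul_one]
  have hfu : f u = 0 := Set.indicator_of_notMem Set.self_notMem_Ioi _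
  obtain ⟨-, hle⟩ := integral_comp_abs_le hg_meas hg_nonneg hG hu0.le
    (fun θ hθ => hbound θ (hu.trans_lt hθ)) hf_mono
    (fun θ => Set.indicator_nonneg (fun _ _ => zero_le_one) θ)
    ((integrableOn_congr_fun hkf measurableSet_Ioi).2
      (integrableOn_Ioi_rpow_of_lt hexponent hu0))
  calc G.real {θ | u < |θ|} = ∫ θ, f |θ| ∂G :=
        (integral_indicator_one (measurableSet_setOf_lt_abs u)).symm
    _ ≤ f u + 2 * C * ∫ θ in Set.Ioi u, θ ^ (-ν - 1) * f θ := hle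
    _ = 2 * C / ν * u ^ (-ν) := by
        rw [setIntegral_congr_fun measurableSet_Ioi hkf, integral_Ioi_rpow_of_lt hexponent hu0, hfu,
          sub_add_cancel, zero_add]
        field_simp

theorem le_mul_two_mul_exp {s t : ℝ} (hs : Real.exp (ρ * t ^ 2 / 2) / 2 ≤ s) :
    t ≤ s * (2 * Real.exp (t - min ρ 0 * t ^ 2 / 2)) := by
  have hρ := mul_le_mul_of_nonneg_right (min_le_left ρ 0) (sq_nonneg t)
  calc t ≤ Real.exp t := by linarith [Real.add_one_le_exp t]
    _ ≤ Real.exp (ρ * t ^ 2 / 2 + (t - min ρ 0 * t ^ 2 / 2)) :=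
        Real.exp_le_exp.2 (by linarith)
    _ = Real.exp (ρ * t ^ 2 / 2) / 2 * (2 * Real.exp (t - min ρ 0 * t ^ 2 / 2)) := by
        rw [Real.exp_add]
        ring
    _ ≤ s * (2 * Real.exp (t - min ρ 0 * t ^ 2 / 2)) := by gcongr

theorem exists_le_exceedanceProb_of_polynomial_tail (hg_meas : Measurable g)
    (hg_nonneg : ∀ θ, 0 ≤ g θ) (hG : G = volume.withDensity fun θ => ENNReal.ofReal (g θ))
    (hν : 0 < ν) (hσ : σ ~[atTop] fun n : ℕ => (n : ℝ) ^ ρ)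
    (h : (fun θ : ℝ => θ ^ (-ν - 1)) =O[atTop] g) :
    ∃ c K : ℝ, 0 < c ∧ ∀ᶠ n : ℕ in atTop,
      c * Real.exp ((min (ν * ρ + 1) 1 - 1) * sqrtTwoLog n ^ 2 / 2 - K * sqrtTwoLog n) ≤
        exceedanceProb (scaleFamily G σ n) (sqrtTwoLog n) := by
  obtain ⟨A, c, -, hc, hlow⟩ := exists_mul_le hg_nonneg h
  refine ⟨c * 4 ^ (-ν - 1) * 2 * ((√(2 * Real.pi))⁻¹ * Real.exp (-(0 + 1) ^ 2 / 2)), ν,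
    by positivity, ?_⟩
  filter_upwards [eventually_mem_Icc_of_isEquivalent_rpow hσ,
    tendsto_sqrtTwoLog.eventually_ge_atTop A] with n hσn hA
  set t := sqrtTwoLog n
  have ht : 0 ≤ t := sqrtTwoLog_nonneg n
  set v := t - min ρ 0 * t ^ 2 / 2 with hv
  have htv : t ≤ v := by
    linarith [mul_nonpos_of_nonpos_of_nonneg (min_le_right ρ 0) (sq_nonneg t)]
  have hvu : v ≤ 2 * Real.exp v := by linarith [Real.add_one_le_exp v, Real.exp_pos v]
  have hdensity : ∀ θ ∈ Set.Ioc (2 * Real.exp v) (2 * Real.exp v + 2 * Real.exp v),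
      c * (4 * Real.exp v) ^ (-ν - 1) ≤ g θ := by
    intro θ hθ
    have hθ0 : 0 < θ := (by positivity : 0 < 2 * Real.exp v).trans hθ.1
    refine le_trans ?_ (hlow θ ((hA.trans (htv.trans hvu)).trans hθ.1.le))
    exact mul_le_mul_of_nonneg_left (Real.rpow_le_rpow_of_nonpos hθ0 (by linarith [hθ.2])
      (by linarith)) hc.le
  refine le_of_eq_of_le ?_ (mul_le_exceedanceProb_scaleFamily hg_meas hg_nonneg hG
    ((by positivity : 0 < Real.exp (ρ * t ^ 2 / 2) / 2).trans_le hσn.1) le_rfl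
    (by positivity : 0 ≤ 2 * Real.exp v)
    ((le_mul_two_mul_exp hσn.1).trans_eq (add_zero _).symm) hdensity)
  have hmin : min (ν * ρ + 1) 1 = ν * min ρ 0 + 1 := by
    rw [mul_min_of_nonneg _ _ hν.le, mul_zero, ← min_add_add_right, zero_add]
  have hexponent : (min (ν * ρ + 1) 1 - 1) * t ^ 2 / 2 - ν * t = v * (-ν - 1) + v := by
    rw [hmin]
    ring
  rw [hexponent, Real.exp_add, Real.mul_rpow four_pos.le (Real.exp_pos v).le, ← Real.exp_mul]
  ring

theorem exists_scaleFamily_real_setOf_one_lt_abs_le (hg_meas : Measurable g)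
    (hg_nonneg : ∀ θ, 0 ≤ g θ) (hG : G = volume.withDensity fun θ => ENNReal.ofReal (g θ))
    (hν : 0 < ν) (hρ : ρ < 0) (hσ : σ ~[atTop] fun n : ℕ => (n : ℝ) ^ ρ)
    (hright : g =O[atTop] fun θ : ℝ => θ ^ (-ν - 1))
    (hleft : (fun θ => g (-θ)) =O[atTop] fun θ : ℝ => θ ^ (-ν - 1)) :
    ∃ C : ℝ, 0 ≤ C ∧ ∀ᶠ n : ℕ in atTop, (scaleFamily G σ n).real {m | 1 < |m|} ≤
      C * Real.exp (ν * ρ * sqrtTwoLog n ^ 2 / 2) := by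
  obtain ⟨C, hC, htail⟩ :=
    exists_real_setOf_lt_abs_le_of_polynomial_tail hg_meas hg_nonneg hG hν hright hleft
  have hσ_zero : Tendsto σ atTop (𝓝 0) := by
    refine hσ.symm.tendsto_nhds ?_
    simpa only [neg_neg, Function.comp_def] using
      (tendsto_rpow_neg_atTop (neg_pos.2 hρ)).comp tendsto_natCast_atTop_atTop
  have hσ_bounds := eventually_mem_Icc_of_isEquivalent_rpow hσ
  have hσ_pos : ∀ᶠ n in atTop, 0 < σ n :=
    hσ_bounds.mono fun n hn => (half_pos (Real.exp_pos _)).trans_le hn.1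
  have hinv : Tendsto (fun n => (σ n)⁻¹) atTop atTop :=
    tendsto_inv_nhdsGT_zero.comp (tendsto_nhdsWithin_iff.2 ⟨hσ_zero, hσ_pos⟩)
  refine ⟨C * 2 ^ ν, by positivity, ?_⟩
  filter_upwards [hσ_bounds, hσ_pos, hinv.eventually htail] with n hσn hσ0 hn
  calc (scaleFamily G σ n).real {m | 1 < |m|} = G.real {θ | (σ n)⁻¹ < |θ|} := by
        rw [scaleFamily_real_setOf_lt_abs hσ0, one_div]
    _ ≤ C * (σ n)⁻¹ ^ (-ν) := hn
    _ = C * σ n ^ ν := by rw [Real.inv_rpow hσ0.le, Real.rpow_neg hσ0.le, inv_inv]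
    _ ≤ C * (2 * Real.exp (ρ * sqrtTwoLog n ^ 2 / 2)) ^ ν := by
        gcongr
        exact hσn.2
    _ = C * 2 ^ ν * Real.exp (ν * ρ * sqrtTwoLog n ^ 2 / 2) := by
        rw [Real.mul_rpow two_pos.le (Real.exp_pos _).le, ← Real.exp_mul, mul_assoc]
        ring_nf

theorem exists_smoothedTail_le_of_polynomial_tail (hg_meas : Measurable g)
    (hg_nonneg : ∀ θ, 0 ≤ g θ) (hG : G = volume.withDensity fun θ => ENNReal.ofReal (g θ))
    (hν : 0 < ν) (hρ0 : ρ < 0) (hρ : -(1 / 2) ≤ ν * ρ)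
    (hσ : σ ~[atTop] fun n : ℕ => (n : ℝ) ^ ρ)
    (hright : g =O[atTop] fun θ : ℝ => θ ^ (-ν - 1))
    (hleft : (fun θ => g (-θ)) =O[atTop] fun θ : ℝ => θ ^ (-ν - 1)) :
    ∃ C K : ℝ, ∀ᶠ n : ℕ in atTop, ∀ y ∈ Set.Icc 0 (sqrtTwoLog n),
      smoothedTail (scaleFamily G σ n) y ≤
        C * Real.exp (-y ^ 2 / 4 + (ν * ρ + 1 - 1 / 2) * sqrtTwoLog n ^ 2 / 2 +
          K * sqrtTwoLog n) := by
  obtain ⟨C, hC, hlarge⟩ :=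
    exists_scaleFamily_real_setOf_one_lt_abs_le hg_meas hg_nonneg hG hν hρ0 hσ hright hleft
  refine ⟨1 + C, 1, ?_⟩
  filter_upwards [hlarge] with n hn y ⟨hy0, hyt⟩
  set t := sqrtTwoLog n
  set E := -y ^ 2 / 4 + (ν * ρ + 1 - 1 / 2) * t ^ 2 / 2 + 1 * t with hE
  have hyt_sq : y ^ 2 ≤ t ^ 2 := pow_le_pow_left₀ hy0 hyt 2
  have hνρ_sq : 0 ≤ (ν * ρ + 1 / 2) * t ^ 2 := mul_nonneg (by linarith) (sq_nonneg t)
  have hsmall : -(max (y - 1) 0) ^ 2 / 2 ≤ E := by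
    rcases le_total (y - 1) 0 with hy1 | hy1
    · rw [max_eq_right hy1]
      nlinarith
    · rw [max_eq_left hy1]
      nlinarith
  calc smoothedTail (scaleFamily G σ n) y
      ≤ Real.exp (-(max (y - 1) 0) ^ 2 / 2) + (scaleFamily G σ n).real {m | 1 < |m|} :=
        smoothedTail_le_add_real _ 1 y
    _ ≤ Real.exp E + C * Real.exp E := by
        refine add_le_add (Real.exp_le_exp.2 hsmall) (hn.trans ?_)
        exact mul_le_mul_of_nonneg_left (Real.exp_le_exp.2 (by linarith)) hC
    _ = (1 + C) * Real.exp E := by ring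

theorem maxTestAttainsCriticalSparsity_polynomial (hg_meas : Measurable g)
    (hg_nonneg : ∀ θ, 0 ≤ g θ) (hG : G = volume.withDensity fun θ => ENNReal.ofReal (g θ))
    (hν : 0 < ν) (hρ : -(2 * ν)⁻¹ ≤ ρ) (hσ : σ ~[atTop] fun n : ℕ => (n : ℝ) ^ ρ)
    (hright : g =Θ[atTop] fun θ : ℝ => θ ^ (-ν - 1))
    (hleft : (fun θ => g (-θ)) =O[atTop] fun θ : ℝ => θ ^ (-ν - 1)) :
    MaxTestAttainsCriticalSparsity (scaleFamily G σ) (min (ν * ρ + 1) 1) := by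
  have hνρ : -(1 / 2) ≤ ν * ρ := by
    calc -(1 / 2) = ν * -(2 * ν)⁻¹ := by field_simp
      _ ≤ ν * ρ := mul_le_mul_of_nonneg_left hρ hν.le
  refine maxTestAttainsCriticalSparsity_of_exp_bounds (le_min (by linarith) zero_le_one)
    (min_le_right _ _)
    (exists_le_exceedanceProb_of_polynomial_tail hg_meas hg_nonneg hG hν hσ hright.2)
    fun hlt => ?_
  have hνρ0 : ν * ρ < 0 := by linarith [(min_lt_iff.1 hlt).resolve_right (lt_irrefl 1)]
  rw [min_eq_left (by linarith)]
  exact exists_smoothedTail_le_of_polynomial_tail hg_meas hg_nonneg hG hν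
    (neg_of_mul_neg_right hνρ0 hν.le) hνρ hσ hright.1 hleft

end PolynomialTail

end GlobalNull

theorem corollary1 (G : Measure ℝ) [IsProbabilityMeasure G] (g : ℝ → ℝ)
    (hg_meas : Measurable g) (hg_nonneg : ∀ θ, 0 ≤ g θ)
    (hG : G = volume.withDensity fun θ => ENNReal.ofReal (g θ)) :
    -- polynomial tail
    (∀ (ν ρ : ℝ) (σ : ℕ → ℝ), 0 < ν → -(2 * ν)⁻¹ < ρ →
      σ ~[atTop] (fun n : ℕ => (n : ℝ) ^ ρ) →
      g =Θ[atTop] (fun θ : ℝ => θ ^ (-ν - 1)) →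
      (fun θ : ℝ => g (-θ)) =O[atTop] (fun θ : ℝ => θ ^ (-ν - 1)) →
      GlobalNull.MaxTestAttainsCriticalSparsity (GlobalNull.scaleFamily G σ)
        (min (ν * ρ + 1) 1)) ∧
    -- exponential tail
    (∀ r : ℝ, √2 / (√2 - 1) < r →
      g =Θ[atTop] (fun θ : ℝ => Real.exp (-θ)) →
      (fun θ : ℝ => g (-θ)) =O[atTop] (fun θ : ℝ => Real.exp (-θ)) →
      GlobalNull.MaxTestAttainsCriticalSparsity
        (GlobalNull.scaleFamily G fun n : ℕ => r * (2 * Real.log n) ^ (-(1 / 2) : ℝ))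
        ((1 - 1 / r) ^ 2)) ∧
    -- Gaussian tail
    (∀ r γ γ' : ℝ, 1 < r →
      g =Θ[atTop] (fun θ : ℝ => Real.exp (-(θ - γ) ^ 2 / 2)) →
      (fun θ : ℝ => g (-θ)) =O[atTop] (fun θ : ℝ => Real.exp (-(θ - γ') ^ 2 / 2)) →
      GlobalNull.MaxTestAttainsCriticalSparsity (GlobalNull.scaleFamily G fun _ : ℕ => r)
        (r ^ 2 / (r ^ 2 + 1))) := by
  refine ⟨fun ν ρ σ hν hρ hσ hright hleft => ?_, fun r hr hright hleft => ?_,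
    fun r γ γ' hr hright hleft => ?_⟩
  · exact GlobalNull.maxTestAttainsCriticalSparsity_polynomial hg_meas hg_nonneg hG hν hρ.le hσ
      hright hleft
  · simp only [GlobalNull.mul_two_log_rpow_eq_div_sqrtTwoLog]
    exact GlobalNull.maxTestAttainsCriticalSparsity_exponential hg_meas hg_nonneg hG hr.le
      hright hleft
  · exact GlobalNull.maxTestAttainsCriticalSparsity_gaussian hg_meas hg_nonneg hG hr.le
      hright hleft
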